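/- Let $H$ be a separable complex Hilbert space. For a bounded operator $T$ on $H$ let $s_n(T)$ ($n\ge 0$) be its singular values, i.e. the operator-norm distance from $T$ to the operators of rank at most $n$, and for $1\le p<\infty$ let $C_p(H)$ be the Schatten class of all $T\in L(H)$ with $\|T\|_{C_p}=\big(\sum_n s_n(T)^p\big)^{1/p}<\infty$. Let $P$ and $Q$ be spectral measures on $\mathbb R$ acting on $H$ (orthogonal projection valued, multiplicative, with value $I$ on $\mathbb R$, and $\sigma$-additive in the strong operator topology on the Borel sets). For $T\in C_1(H)$ and a Borel function $\varphi:\mathbb R^2\to\mathbb C$, write $\int\varphi\,d(PTQ)$ for the operator $S\in L(H)$ (when it exists) such that, for all $h,k\in H$, the set function $E\times F\mapsto\langle P(E)TQ(F)h,k\rangle$ on Borel rectangles extends to a complex measure $m_{h,k}$ on $\mathbb R^2$, $\varphi$ is $m_{h,k}$-integrable, and $\langle Sh,k\rangle=\int\varphi\,dm_{h,k}$. Let $\mathfrak S=C_p(H)$ with $1\le p<\infty$, or $\mathfrak S=L(H)$ with the operator norm. The double operator integral $\int\varphi\,d(P\otimes Q)_{\mathfrak S}$ is the bounded linear operator $\Phi$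 on $\mathfrak S$ with $\Phi(T)=\int\varphi\,d(PTQ)$ for all $T\in C_1(H)$, which in the case $\mathfrak S=L(H)$ is moreover required to be ultraweakly continuous. **Theorem.** Let $f\in L^1(\mathbb R)$ (complex valued), $\hat f(\xi)=\int_{\mathbb R}e^{-i\xi x}f(x)\,dx$, and $\varphi(\lambda,\mu)=\hat f(\lambda-\mu)$. Then, for $\mathfrak S=C_p(H)$ with any $1\le p<\infty$ and for $\mathfrak S=L(H)$, the double operator integral $\int_{\mathbb R\times\mathbb R}\varphi\,d(P\otimes Q)_{\mathfrak S}$ exists as a bounded operator on $\mathfrak S$, is uniquely determined, and satisfies $$\Big\|\int_{\mathbb R\times\mathbb R}\varphi\,d(P\otimes Q)_{\mathfrak S}\Big\|_{\mathcal L(\mathfrak S)}\le\|f\|_1 .$$ -/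

import Mathlib

open MeasureTheory TopologicalSpace

noncomputable section

/-- A spectral measure on a measurable space `α` acting on a Hilbert space `H`: a map from the
measurable sets to the orthogonal projections on `H` that is multiplicative, sends the whole space
to the identity and is `σ`-additive in the strong operator topology. The values of `toFun` on
non-measurable sets are irrelevant and never used. -/
structure SpectralMeasure (α : Type*) [MeasurableSpace α] (H : Type*) [NormedAddCommGroup H]
    [InnerProductSpace ℂ H] [CompleteSpace H] where
  toFun : Set α → H →L[ℂ] H
  isStarProjection : ∀ E, MeasurableSet E → IsStarProjection (toFun E)
  univ : toFun Set.univ = 1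
  inter : ∀ E F, MeasurableSet E → MeasurableSet F → toFun (E ∩ F) = toFun E * toFun F
  hasSum : ∀ E : ℕ → Set α, (∀ n, MeasurableSet (E n)) → Pairwise (fun m n => Disjoint (E m) (E n)) →
    ∀ x : H, HasSum (fun n => toFun (E n) x) (toFun (⋃ n, E n) x)

section Schatten

variable {H : Type*} [NormedAddCommGroup H] [InnerProductSpace ℂ H]

/-- The `n`-th singular value (counted from `0`) of a bounded operator `T` on a Hilbert space: the
distance in operator norm from `T` to the operators of rank at most `n`. -/
def singularValue (T : H →L[ℂ] H) (n : ℕ) : ℝ :=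
  ⨅ F : {F : H →L[ℂ] H // LinearMap.rank (F : H →ₗ[ℂ] H) ≤ (n : Cardinal)}, ‖T - F‖

/-- `T` belongs to the Schatten class `C_p`: its singular values are `p`-summable. -/
def MemSchatten (p : ℝ) (T : H →L[ℂ] H) : Prop :=
  Summable fun n => singularValue T n ^ p

/-- The Schatten norm `‖T‖_{C_p}`, the `ℓ^p` norm of the sequence of singular values of `T`. -/
def schattenNorm (p : ℝ) (T : H →L[ℂ] H) : ℝ :=
  (∑' n, singularValue T n ^ p) ^ (1 / p)

theorem singularValue_nonneg (T : H →L[ℂ] H) (n : ℕ) : 0 ≤ singularValue T n :=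
  Real.iInf_nonneg fun _ => norm_nonneg _

theorem singularValue_le (T F : H →L[ℂ] H) (n : ℕ)
    (hF : LinearMap.rank (F : H →ₗ[ℂ] H) ≤ (n : Cardinal)) : singularValue T n ≤ ‖T - F‖ :=
  ciInf_le ⟨0, by rintro _ ⟨G, rfl⟩; exact norm_nonneg _⟩
    (⟨F, hF⟩ : {F : H →L[ℂ] H // LinearMap.rank (F : H →ₗ[ℂ] H) ≤ (n : Cardinal)})

theorem exists_norm_sub_lt (T : H →L[ℂ] H) (n : ℕ) {ε : ℝ} (hε : 0 < ε) :
    ∃ F : H →L[ℂ] H, LinearMap.rank (F : H →ₗ[ℂ] H) ≤ (n : Cardinal) ∧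
      ‖T - F‖ < singularValue T n + ε := by
  have : Nonempty {F : H →L[ℂ] H // LinearMap.rank (F : H →ₗ[ℂ] H) ≤ (n : Cardinal)} :=
    ⟨⟨0, by simp⟩⟩
  obtain ⟨F, hF⟩ := exists_lt_of_ciInf_lt (lt_add_of_pos_right (singularValue T n) hε)
  exact ⟨F.1, F.2, hF⟩

theorem singularValue_antitone (T : H →L[ℂ] H) : Antitone (singularValue T) := by
  intro m n hmn
  refine le_of_forall_pos_le_add fun ε hε => ?_
  obtain ⟨F, hF, hlt⟩ := exists_norm_sub_lt T m hε
  exact (singularValue_le T F n (hF.trans (by exact_mod_cast hmn))).trans hlt.le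

theorem singularValue_add_le (S T : H →L[ℂ] H) (m n : ℕ) :
    singularValue (S + T) (m + n) ≤ singularValue S m + singularValue T n := by
  refine le_of_forall_pos_le_add fun ε hε => ?_
  obtain ⟨F, hF, h1⟩ := exists_norm_sub_lt S m (half_pos hε)
  obtain ⟨G, hG, h2⟩ := exists_norm_sub_lt T n (half_pos hε)
  have h3 : singularValue (S + T) (m + n) ≤ ‖(S + T) - (F + G)‖ := by
    apply singularValue_le
    refine (LinearMap.rank_add_le (F : H →ₗ[ℂ] H) (G : H →ₗ[ℂ] H)).trans ?_
    push_cast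
    exact add_le_add hF hG
  have h4 : ‖(S + T) - (F + G)‖ ≤ ‖S - F‖ + ‖T - G‖ := by
    rw [add_sub_add_comm]; exact norm_add_le _ _
  linarith

theorem singularValue_zero (n : ℕ) : singularValue (0 : H →L[ℂ] H) n = 0 :=
  le_antisymm (by simpa using singularValue_le (0 : H →L[ℂ] H) 0 n (by simp))
    (singularValue_nonneg _ _)

theorem singularValue_smul_le (c : ℂ) (T : H →L[ℂ] H) (n : ℕ) :
    singularValue (c • T) n ≤ ‖c‖ * singularValue T n := by
  refine le_of_forall_pos_le_add fun ε hε => ?_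
  have hc : 0 < ‖c‖ + 1 := by positivity
  obtain ⟨F, hF, h1⟩ := exists_norm_sub_lt T n (div_pos hε hc)
  have h2 : singularValue (c • T) n ≤ ‖c • T - c • F‖ := by
    refine singularValue_le _ _ _ (le_trans ?_ hF)
    have : ((c • F : H →L[ℂ] H) : H →ₗ[ℂ] H) = (c • LinearMap.id).comp (F : H →ₗ[ℂ] H) := by
      ext x; simp
    rw [this]
    exact LinearMap.rank_comp_le_right _ _
  rw [← smul_sub, norm_smul] at h2
  have h3 : ‖c‖ * ‖T - F‖ ≤ ‖c‖ * (singularValue T n + ε / (‖c‖ + 1)) := by gcongr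
  have h4 : ‖c‖ * (ε / (‖c‖ + 1)) ≤ ε := by
    rw [← mul_div_assoc, div_le_iff₀ hc]; nlinarith [norm_nonneg c]
  linarith [mul_add ‖c‖ (singularValue T n) (ε / (‖c‖ + 1))]

theorem MemSchatten.add {p : ℝ} (hp : 1 ≤ p) {S T : H →L[ℂ] H} (hS : MemSchatten p S)
    (hT : MemSchatten p T) : MemSchatten p (S + T) := by
  have hp0 : 0 ≤ p := by linarith
  have key : ∀ n, ∀ k, 2 * n ≤ k → singularValue (S + T) k ^ p ≤
      2 ^ p * (singularValue S n ^ p + singularValue T n ^ p) := by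
    intro n k hk
    have hs := singularValue_nonneg S n
    have ht := singularValue_nonneg T n
    have h1 : singularValue (S + T) k ≤ singularValue S n + singularValue T n :=
      (singularValue_antitone _ (by omega : n + n ≤ k)).trans (singularValue_add_le S T n n)
    have h2 : singularValue S n + singularValue T n ≤
        2 * max (singularValue S n) (singularValue T n) := by
      linarith [le_max_left (singularValue S n) (singularValue T n),
        le_max_right (singularValue S n) (singularValue T n)]
    refine (Real.rpow_le_rpow (singularValue_nonneg _ _) (h1.trans h2) hp0).trans ?_
    rw [Real.mul_rpow (by norm_num) (le_max_of_le_left hs)]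
    gcongr
    rcases max_choice (singularValue S n) (singularValue T n) with h | h <;> rw [h]
    · exact le_add_of_nonneg_right (Real.rpow_nonneg ht p)
    · exact le_add_of_nonneg_left (Real.rpow_nonneg hs p)
  have hsum : Summable fun n => 2 ^ p * (singularValue S n ^ p + singularValue T n ^ p) :=
    Summable.mul_left _ (Summable.add (f := fun n => singularValue S n ^ p) hS hT)
  have he : Summable fun n => singularValue (S + T) (2 * n) ^ p :=
    Summable.of_nonneg_of_le (fun n => Real.rpow_nonneg (singularValue_nonneg _ _) p)
      (fun n => key n _ le_rfl) hsum
  have ho : Summable fun n => singularValue (S + T) (2 * n + 1) ^ p :=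
    Summable.of_nonneg_of_le (fun n => Real.rpow_nonneg (singularValue_nonneg _ _) p)
      (fun n => key n _ (by omega)) hsum
  exact (HasSum.even_add_odd (f := fun n => singularValue (S + T) n ^ p)
    he.hasSum ho.hasSum).summable

theorem MemSchatten.smul {p : ℝ} (hp : 1 ≤ p) (c : ℂ) {T : H →L[ℂ] H} (hT : MemSchatten p T) :
    MemSchatten p (c • T) := by
  refine Summable.of_nonneg_of_le (fun n => Real.rpow_nonneg (singularValue_nonneg _ _) p)
    (fun n => ?_) (Summable.mul_left (‖c‖ ^ p) hT)
  rw [← Real.mul_rpow (norm_nonneg c) (singularValue_nonneg _ _)]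
  exact Real.rpow_le_rpow (singularValue_nonneg _ _) (singularValue_smul_le c T n) (by linarith)

variable (H) in
/-- The Schatten class `C_p(H)`, `1 ≤ p < ∞`, as a linear subspace of the bounded operators. -/
def schattenClass (p : ℝ) (hp : 1 ≤ p) : Submodule ℂ (H →L[ℂ] H) where
  carrier := {T | MemSchatten p T}
  zero_mem' := by
    have : (0 : ℝ) ^ p = 0 := Real.zero_rpow (by linarith)
    simp [MemSchatten, singularValue_zero, this, summable_zero]
  add_mem' hS hT := MemSchatten.add hp hS hT
  smul_mem' c _ hT := MemSchatten.smul hp c hT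

/-- A linear functional `ω` on the bounded operators is ultraweakly continuous when it has the form
`T ↦ ∑ ⟪v n, T (u n)⟫` with `∑ ‖u n‖² < ∞` and `∑ ‖v n‖² < ∞`. -/
def IsUltraweaklyContinuous (ω : (H →L[ℂ] H) →ₗ[ℂ] ℂ) : Prop :=
  ∃ u v : ℕ → H, Summable (fun n => ‖u n‖ ^ 2) ∧ Summable (fun n => ‖v n‖ ^ 2) ∧
    ∀ T : H →L[ℂ] H, HasSum (fun n => inner ℂ (v n) (T (u n))) (ω T)

end Schatten

section DoubleOperatorIntegral

variable {α β : Type*} [MeasurableSpace α] [MeasurableSpace β]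
variable {H : Type*} [NormedAddCommGroup H] [InnerProductSpace ℂ H] [CompleteSpace H]

/-- `S = ∫ φ d(P T Q)`: for all vectors `h`, `k`, the set function `E × F ↦ ⟪k, P(E) T Q(F) h⟫` on
measurable rectangles is the restriction of a complex measure on `α × β` (necessarily unique),
the function `φ` is integrable with respect to it, and its integral is `⟪k, S h⟫`. -/
def HasOperatorIntegral (P : SpectralMeasure α H) (Q : SpectralMeasure β H) (φ : α × β → ℂ)
    (T S : H →L[ℂ] H) : Prop :=
  ∀ h k : H, ∃ m : ComplexMeasure (α × β),
    (∀ E F, MeasurableSet E → MeasurableSet F →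
      m (E ×ˢ F) = inner ℂ k (P.toFun E (T (Q.toFun F h)))) ∧
    m.Integrable φ ∧
    inner ℂ k (S h) = m.integral φ (ContinuousLinearMap.mul ℝ ℂ)

/-- `Φ = ∫ φ d(P ⊗ Q)` on the Schatten class `C_p(H)`: `Φ` is the bounded linear operator on `C_p(H)`
with `Φ T = ∫ φ d(P T Q)` for every trace class operator `T`. -/
structure IsDoubleOperatorIntegralSchatten (P : SpectralMeasure α H) (Q : SpectralMeasure β H)
    (φ : α × β → ℂ) (p : ℝ) (hp : 1 ≤ p)
    (Φ : schattenClass H p hp →ₗ[ℂ] schattenClass H p hp) : Prop where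
  bounded : ∃ C : ℝ, ∀ T : schattenClass H p hp,
    schattenNorm p (Φ T : H →L[ℂ] H) ≤ C * schattenNorm p (T : H →L[ℂ] H)
  apply_traceClass : ∀ T : schattenClass H p hp, MemSchatten 1 (T : H →L[ℂ] H) →
    HasOperatorIntegral P Q φ (T : H →L[ℂ] H) (Φ T : H →L[ℂ] H)

/-- `Φ = ∫ φ d(P ⊗ Q)` on `L(H)`: `Φ` is the bounded linear operator on `L(H)` that is ultraweakly
continuous (equivalently, the adjoint of a bounded operator on the trace class, with respect to the
trace duality) and satisfies `Φ T = ∫ φ d(P T Q)` for every trace class operator `T`. -/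
structure IsDoubleOperatorIntegralBounded (P : SpectralMeasure α H) (Q : SpectralMeasure β H)
    (φ : α × β → ℂ) (Φ : (H →L[ℂ] H) →L[ℂ] (H →L[ℂ] H)) : Prop where
  ultraweak : ∀ ω : (H →L[ℂ] H) →ₗ[ℂ] ℂ, IsUltraweaklyContinuous ω →
    IsUltraweaklyContinuous (ω ∘ₗ (Φ : (H →L[ℂ] H) →ₗ[ℂ] (H →L[ℂ] H)))
  apply_traceClass : ∀ T : H →L[ℂ] H, MemSchatten 1 T → HasOperatorIntegral P Q φ T (Φ T)

end DoubleOperatorIntegral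

/-- The Fourier transform `ξ ↦ ∫ e^{-iξx} f(x) dx` of an integrable function on the line. -/
def fourierHat (f : ℝ → ℂ) (ξ : ℝ) : ℂ :=
  ∫ x : ℝ, Complex.exp (-(Complex.I * ξ * x)) * f x

end

/-!
Write `U(t) = ∫ e^{-itλ} dP(λ)` and `V(t) = ∫ e^{itμ} dQ(μ)`. Since
`φ(λ, μ) = ∫ f(t) e^{-itλ} e^{itμ} dt`, the double operator integral has to be the average
`Φ(T) = ∫ f(t) U(t) T V(t) dt`, taken in the strong operator topology. The operators `U(t)` and
`V(t)` are contractions, so `‖Φ‖ ≤ ‖f‖₁` on `L(H)`.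

*The average computes the integral.* A trace class operator is a sum of rank one operators
`⟪u, ·⟫ v` with square summable norms (`MemSchatten.exists_hasSum_rankOne`), hence
`E × F ↦ ⟪k, P(E) T Q(F) h⟫` extends to a sum of product measures
(`MemSchatten.exists_complexMeasure`). Every complex measure has a density with respect to a finite
positive measure, so Fubini's theorem applies (`ComplexMeasure.cintegral_integral`) and gives
`∫ φ d(PTQ) = Φ(T)` (`hasOperatorIntegral_fourierHat`).

*Schatten norms.* Singular values are approximation numbers here, so convexity of the Schatten norm
is not at hand. It is replaced by Ky Fan's principle: `∑_{n < N} s_n(S)` is the supremum of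
`|∑_{n < N} ⟪f n, S (e n)⟫|` over orthonormal systems. Its upper half
(`norm_sum_inner_le_sum_singularValue`), applied to `U(t) T V(t)` for each `t`, and its lower half
(`exists_sum_singularValue_le`), applied to `Φ(T)`, give
`∑_{n < N} s_n(Φ T) ≤ ‖f‖₁ ∑_{n < N} s_n(T)` for all `N`, and weak majorization passes to `p`-th
powers (`sum_rpow_le_sum_rpow_of_majorized`). Uniqueness on `C_p(H)` follows from density of the
finite rank operators.

*Ultraweak continuity.* If `ω` is ultraweakly continuous, then `ω ∘ Φ` is bounded and, by dominated
convergence, continuous along the finite rank truncations `T π_N → T`. Such a functional is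
`T ↦ tr(ρ T)` for a bounded operator `ρ` on finite rank operators, and the lower half of Ky Fan's
principle shows that `ρ` is of trace class (`isUltraweaklyContinuous_of_tendsto`). The same
truncations reduce uniqueness on `L(H)` to finite rank operators.
-/

noncomputable section

/-! ### Complex measures -/

/-- Induction principle: bounded measurable functions are obtained from indicators of measurable
sets by linear combinations and bounded pointwise limits. -/
theorem Measurable.bounded_induction {X : Type*} [MeasurableSpace X] {p : (X → ℂ) → Prop}
    (indicator : ∀ (c : ℂ) (s : Set X), MeasurableSet s → p (s.indicator fun _ => c))
    (add : ∀ f g : X → ℂ, Measurable f → Measurable g → (∃ C, ∀ x, ‖f x‖ ≤ C) →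
      (∃ C, ∀ x, ‖g x‖ ≤ C) → p f → p g → p (f + g))
    (lim : ∀ (F : ℕ → X → ℂ) (f : X → ℂ) (C : ℝ), (∀ n, Measurable (F n)) → Measurable f →
      (∀ n x, ‖F n x‖ ≤ C) → (∀ x, ‖f x‖ ≤ C) →
      (∀ x, Filter.Tendsto (fun n => F n x) Filter.atTop (nhds (f x))) → (∀ n, p (F n)) → p f)
    {f : X → ℂ} (hf : Measurable f) {C : ℝ} (hC : ∀ x, ‖f x‖ ≤ C) : p f := by
  have hsimple : ∀ g : SimpleFunc X ℂ, p g := by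
    intro g
    induction g using SimpleFunc.induction with
    | @const c s hs =>
      have := indicator c s hs
      convert this using 1
      ext x
      by_cases hx : x ∈ s <;> simp [Set.piecewise, hx]
    | @add f g _ hf hg =>
      exact add f g f.measurable g.measurable f.exists_forall_norm_le g.exists_forall_norm_le hf hg
  refine lim (fun n => SimpleFunc.approxOn f hf Set.univ 0 (Set.mem_univ _) n) f (C + C)
    (fun n => SimpleFunc.measurable _) hf (fun n x => ?_) (fun x => ?_) (fun x => ?_)
    (fun n => hsimple _)
  · exact (SimpleFunc.norm_approxOn_zero_le hf (Set.mem_univ _) x n).trans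
      (add_le_add (hC x) (hC x))
  · exact (hC x).trans (le_add_of_nonneg_left ((norm_nonneg _).trans (hC x)))
  · exact SimpleFunc.tendsto_approxOn hf (Set.mem_univ _) (by simp)

namespace MeasureTheory.ComplexMeasure

variable {X : Type*} [MeasurableSpace X]

/-- Every complex measure has a density with respect to a finite positive measure. -/
theorem exists_eq_withDensity (m : ComplexMeasure X) :
    ∃ (ν : Measure X) (θ : X → ℂ), IsFiniteMeasure ν ∧ Integrable θ ν ∧ m = ν.withDensityᵥ θ := by
  -- real and imaginary part are absolutely continuous with respect to the sum of their variations
  set ν : Measure X := m.re.totalVariation + m.im.totalVariation with hν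
  have hre : (ComplexMeasure.re m).totalVariation ≪ ν :=
    Measure.absolutelyContinuous_of_le (Measure.le_add_right le_rfl)
  have him : (ComplexMeasure.im m).totalVariation ≪ ν :=
    Measure.absolutelyContinuous_of_le (Measure.le_add_left le_rfl)
  have h1 := (SignedMeasure.absolutelyContinuous_iff_withDensityᵥ_rnDeriv_eq
    (ComplexMeasure.re m) ν).1 ((SignedMeasure.absolutelyContinuous_ennreal_iff _ _).2 (by
      rwa [VectorMeasure.ennrealToMeasure_toENNRealVectorMeasure]))
  have h2 := (SignedMeasure.absolutelyContinuous_iff_withDensityᵥ_rnDeriv_eq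
    (ComplexMeasure.im m) ν).1 ((SignedMeasure.absolutelyContinuous_ennreal_iff _ _).2 (by
      rwa [VectorMeasure.ennrealToMeasure_toENNRealVectorMeasure]))
  refine ⟨ν, m.rnDeriv ν, inferInstance, m.integrable_rnDeriv ν, ?_⟩
  ext s hs
  have hi := m.integrable_rnDeriv ν
  rw [withDensityᵥ_apply hi hs]
  apply Complex.ext
  · have := congrArg (fun v : SignedMeasure X => v s) h1
    simp only [withDensityᵥ_apply (SignedMeasure.integrable_rnDeriv _ _) hs] at this
    have h3 := integral_re (hi.integrableOn (s := s))
    simp only [RCLike.re_eq_complex_re] at h3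
    rw [← h3]
    exact this.symm
  · have := congrArg (fun v : SignedMeasure X => v s) h2
    simp only [withDensityᵥ_apply (SignedMeasure.integrable_rnDeriv _ _) hs] at this
    have h3 := integral_im (hi.integrableOn (s := s))
    simp only [RCLike.im_eq_complex_im] at h3
    rw [← h3]
    exact this.symm

instance isFiniteMeasure_variation (m : ComplexMeasure X) : IsFiniteMeasure m.variation := by
  obtain ⟨ν, θ, _, hθ, rfl⟩ := m.exists_eq_withDensity
  rw [Measure.variation_withDensityᵥ hθ]
  exact ⟨by simpa using! hθ.2⟩

theorem integrable_of_bounded (m : ComplexMeasure X) {g : X → ℂ} (hg : Measurable g) {C : ℝ}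
    (hC : ∀ x, ‖g x‖ ≤ C) : m.Integrable g :=
  Integrable.of_bound hg.aestronglyMeasurable C (Filter.Eventually.of_forall hC)

/-- The integral of a complex function with respect to a complex measure. -/
abbrev cintegral (m : ComplexMeasure X) (g : X → ℂ) : ℂ :=
  m.integral g (ContinuousLinearMap.mul ℝ ℂ)

theorem cintegral_indicator (m : ComplexMeasure X) (c : ℂ) {s : Set X} (hs : MeasurableSet s) :
    m.cintegral (s.indicator fun _ => c) = c * m s := by
  rw [cintegral, VectorMeasure.integral_indicator_const _ hs]
  simp

theorem cintegral_add (m : ComplexMeasure X) {f g : X → ℂ} (hf : Measurable f) (hg : Measurable g)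
    (hfC : ∃ C, ∀ x, ‖f x‖ ≤ C) (hgC : ∃ C, ∀ x, ‖g x‖ ≤ C) :
    m.cintegral (f + g) = m.cintegral f + m.cintegral g :=
  VectorMeasure.integral_add (m.integrable_of_bounded hf hfC.choose_spec)
    (m.integrable_of_bounded hg hgC.choose_spec)

theorem tendsto_cintegral (m : ComplexMeasure X) {F : ℕ → X → ℂ} {f : X → ℂ} {C : ℝ}
    (hF : ∀ n, Measurable (F n)) (hC : ∀ n x, ‖F n x‖ ≤ C)
    (hlim : ∀ x, Filter.Tendsto (fun n => F n x) Filter.atTop (nhds (f x))) :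
    Filter.Tendsto (fun n => m.cintegral (F n)) Filter.atTop (nhds (m.cintegral f)) :=
  VectorMeasure.tendsto_integral_of_dominated_convergence (fun _ => C)
    (fun n => (hF n).aestronglyMeasurable) (integrable_const C)
    (fun n => Filter.Eventually.of_forall (hC n)) (Filter.Eventually.of_forall hlim)

theorem norm_cintegral_le (m : ComplexMeasure X) {g : X → ℂ} {C : ℝ} (hC : ∀ x, ‖g x‖ ≤ C) :
    ‖m.cintegral g‖ ≤ C * m.variation.real Set.univ := by
  have h := VectorMeasure.norm_integral_le_of_norm_le_const (μ := m)
    (B := ContinuousLinearMap.mul ℝ ℂ) (Filter.Eventually.of_forall hC)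
  simpa using h

theorem cintegral_smul_measure (c : ℂ) (m m' : ComplexMeasure X)
    (h : ∀ s, MeasurableSet s → m' s = c * m s) {g : X → ℂ} (hg : Measurable g) {C : ℝ}
    (hC : ∀ x, ‖g x‖ ≤ C) : m'.cintegral g = c * m.cintegral g := by
  refine Measurable.bounded_induction (p := fun g => m'.cintegral g = c * m.cintegral g)
    (fun a s hs => ?_) (fun f g hf hg hfC hgC h1 h2 => ?_)
    (fun F f C hF _ hC _ hlim ih => ?_) hg hC
  · rw [cintegral_indicator _ _ hs, cintegral_indicator _ _ hs, h s hs]; ring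
  · rw [cintegral_add _ hf hg hfC hgC, cintegral_add _ hf hg hfC hgC, h1, h2]; ring
  · refine tendsto_nhds_unique (tendsto_cintegral m' hF hC hlim) ?_
    simp_rw [ih]
    exact (tendsto_cintegral m hF hC hlim).const_mul c

theorem cintegral_withDensity {ν : Measure X} {θ : X → ℂ} (hθ : Integrable θ ν) {g : X → ℂ}
    (hg : Measurable g) {C : ℝ} (hC : ∀ x, ‖g x‖ ≤ C) :
    cintegral (ν.withDensityᵥ θ) g = ∫ x, g x * θ x ∂ν := by
  refine Measurable.bounded_induction
    (p := fun g => cintegral (ν.withDensityᵥ θ) g = ∫ x, g x * θ x ∂ν)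
    (fun a s hs => ?_) (fun f g hf hg hfC hgC h1 h2 => ?_)
    (fun F f C hF _ hC _ hlim ih => ?_) hg hC
  · rw [cintegral_indicator _ _ hs, withDensityᵥ_apply hθ hs, ← integral_const_mul,
      ← integral_indicator hs]
    congr 1 with x
    by_cases hx : x ∈ s <;> simp [hx]
  · rw [cintegral_add _ hf hg hfC hgC, h1, h2, ← integral_add]
    · simp [add_mul]
    · exact hθ.bdd_mul hf.aestronglyMeasurable (Filter.Eventually.of_forall hfC.choose_spec)
    · exact hθ.bdd_mul hg.aestronglyMeasurable (Filter.Eventually.of_forall hgC.choose_spec)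
  · refine tendsto_nhds_unique (tendsto_cintegral _ hF hC hlim) ?_
    simp_rw [ih]
    refine tendsto_integral_of_dominated_convergence (fun x => C * ‖θ x‖)
      (fun n => (hF n).aestronglyMeasurable.mul hθ.aestronglyMeasurable)
      (hθ.norm.const_mul C) (fun n => Filter.Eventually.of_forall fun x => ?_)
      (Filter.Eventually.of_forall fun x => (hlim x).mul_const _)
    rw [norm_mul]
    exact mul_le_mul_of_nonneg_right (hC n x) (norm_nonneg _)

/-- Fubini's theorem for the product of a complex measure with an absolutely continuous measure
on the line. -/
theorem cintegral_integral (m : ComplexMeasure X) {f : ℝ → ℂ} (hf : Integrable f)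
    {e : ℝ → X → ℂ} (he : Measurable (Function.uncurry e)) (h1 : ∀ t x, ‖e t x‖ ≤ 1)
    {φ : X → ℂ} (hφ : Measurable φ) {C : ℝ} (hC : ∀ x, ‖φ x‖ ≤ C)
    (hφe : ∀ x, φ x = ∫ t, e t x * f t) :
    m.cintegral φ = ∫ t, f t * m.cintegral (e t) := by
  obtain ⟨ν, θ, _, hθ, rfl⟩ := m.exists_eq_withDensity
  rw [cintegral_withDensity hθ hφ hC]
  have : ∀ t, cintegral (ν.withDensityᵥ θ) (e t) = ∫ x, e t x * θ x ∂ν := fun t =>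
    cintegral_withDensity hθ (he.comp measurable_prodMk_left) (h1 t)
  simp_rw [this, hφe, ← integral_const_mul, ← integral_mul_const]
  rw [integral_integral_swap]
  · congr 1 with t
    congr 1 with x
    ring
  · have h2 : Integrable (fun z : X × ℝ => θ z.1 * f z.2) (ν.prod volume) := hθ.mul_prod hf
    have h3 := h2.bdd_mul (f := fun z : X × ℝ => e z.2 z.1) (c := 1)
      (he.comp measurable_swap).aestronglyMeasurable
      (Filter.Eventually.of_forall fun z => h1 _ _)
    refine h3.congr (Filter.Eventually.of_forall fun z => ?_)
    simp only [Function.uncurry]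
    ring

end MeasureTheory.ComplexMeasure

/-! ### Integration against a spectral measure -/

namespace SpectralMeasure

variable {α : Type*} [MeasurableSpace α]
variable {H : Type*} [NormedAddCommGroup H] [InnerProductSpace ℂ H] [CompleteSpace H]

theorem toFun_empty (P : SpectralMeasure α H) : P.toFun ∅ = 0 := by
  ext x
  have h := (P.hasSum (fun _ => ∅) (fun _ => MeasurableSet.empty) (fun _ _ _ => by simp) x).summable
  exact (summable_const_iff _).1 (by simpa only [Set.iUnion_empty] using h)

theorem inner_toFun_left (P : SpectralMeasure α H) {s : Set α} (hs : MeasurableSet s) (k h : H) :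
    inner ℂ (P.toFun s k) h = inner ℂ k (P.toFun s h) := by
  have h1 := (P.isStarProjection s hs).isSelfAdjoint
  rw [ContinuousLinearMap.isSelfAdjoint_iff'] at h1
  conv_lhs => rw [← h1]
  exact ContinuousLinearMap.adjoint_inner_left _ _ _

theorem toFun_toFun (P : SpectralMeasure α H) {s : Set α} (hs : MeasurableSet s) (h : H) :
    P.toFun s (P.toFun s h) = P.toFun s h :=
  congrArg (fun A : H →L[ℂ] H => A h) (P.isStarProjection s hs).isIdempotentElem

theorem inner_toFun_toFun (P : SpectralMeasure α H) {s : Set α} (hs : MeasurableSet s) (k h : H) :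
    inner ℂ (P.toFun s k) (P.toFun s h) = inner ℂ k (P.toFun s h) := by
  rw [P.inner_toFun_left hs, P.toFun_toFun hs]

theorem norm_sq_toFun (P : SpectralMeasure α H) {s : Set α} (hs : MeasurableSet s) (h : H) :
    ‖P.toFun s h‖ ^ 2 = (inner ℂ h (P.toFun s h)).re := by
  rw [← P.inner_toFun_toFun hs, inner_self_eq_norm_sq_to_K]
  norm_cast

theorem norm_toFun_le (P : SpectralMeasure α H) {s : Set α} (hs : MeasurableSet s) (h : H) :
    ‖P.toFun s h‖ ≤ ‖h‖ := by
  have h1 : ‖P.toFun s h‖ ^ 2 ≤ ‖h‖ * ‖P.toFun s h‖ := by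
    rw [P.norm_sq_toFun hs]
    exact (Complex.re_le_norm _).trans (norm_inner_le_norm _ _)
  nlinarith [norm_nonneg (P.toFun s h), norm_nonneg h]

/-- The complex measure `E ↦ ⟪k, P(E) h⟫`. -/
def scalarMeasure (P : SpectralMeasure α H) (k h : H) : ComplexMeasure α where
  measureOf' s := open scoped Classical in
    if MeasurableSet s then inner ℂ k (P.toFun s h) else 0
  empty' := by simp [P.toFun_empty]
  not_measurable' s hs := by simp [hs]
  m_iUnion' E hE hd := by
    simp only [hE, MeasurableSet.iUnion hE, if_true]
    exact (innerSL ℂ k).hasSum (P.hasSum E hE hd h)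

theorem scalarMeasure_apply (P : SpectralMeasure α H) (k h : H) {s : Set α}
    (hs : MeasurableSet s) : P.scalarMeasure k h s = inner ℂ k (P.toFun s h) :=
  if_pos hs

theorem sum_norm_sq_toFun_le (P : SpectralMeasure α H) (h : H) {S : Finset (Set α)}
    (hS : ∀ s ∈ S, MeasurableSet s) (hd : (S : Set (Set α)).PairwiseDisjoint id) :
    ∑ s ∈ S, ‖P.toFun s h‖ ^ 2 ≤ ‖h‖ ^ 2 := by
  have h1 : MeasurableSet (⋃ s ∈ S, s) := Finset.measurableSet_biUnion S hS
  have h2 := VectorMeasure.of_biUnion_finset (v := P.scalarMeasure h h) (f := id) hd hS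
  calc ∑ s ∈ S, ‖P.toFun s h‖ ^ 2 = (∑ s ∈ S, P.scalarMeasure h h s).re := by
        rw [Complex.re_sum]
        exact Finset.sum_congr rfl fun s hs => by
          rw [P.norm_sq_toFun (hS s hs), P.scalarMeasure_apply _ _ (hS s hs)]
    _ = (P.scalarMeasure h h (⋃ s ∈ S, s)).re := congrArg Complex.re h2.symm
    _ = ‖P.toFun (⋃ s ∈ S, s) h‖ ^ 2 := by
        rw [P.scalarMeasure_apply _ _ h1, P.norm_sq_toFun h1]
    _ ≤ ‖h‖ ^ 2 := by gcongr; exact P.norm_toFun_le h1 h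

/-- By the Cauchy-Schwarz inequality for the orthogonal decompositions of `k` and `h` along a
partition, the measure `⟪k, P(·) h⟫` has total variation at most `‖k‖ ‖h‖`. -/
theorem variation_scalarMeasure_le (P : SpectralMeasure α H) (k h : H) :
    (P.scalarMeasure k h).variation Set.univ ≤ ENNReal.ofReal (‖k‖ * ‖h‖) := by
  by_contra! hlt
  obtain ⟨S, -, hd, hS, hsum⟩ :=
    VectorMeasure.exists_lt_sum_of_lt_variation _ MeasurableSet.univ hlt
  refine hsum.not_ge ?_
  simp_rw [← ofReal_norm]
  rw [← ENNReal.ofReal_sum_of_nonneg fun _ _ => norm_nonneg _]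
  refine ENNReal.ofReal_le_ofReal ?_
  calc ∑ s ∈ S, ‖P.scalarMeasure k h s‖ ≤ ∑ s ∈ S, ‖P.toFun s k‖ * ‖P.toFun s h‖ := by
        refine Finset.sum_le_sum fun s hs => ?_
        rw [P.scalarMeasure_apply _ _ (hS s hs), ← P.inner_toFun_toFun (hS s hs)]
        exact norm_inner_le_norm _ _
    _ ≤ √(∑ s ∈ S, ‖P.toFun s k‖ ^ 2) * √(∑ s ∈ S, ‖P.toFun s h‖ ^ 2) :=
        Real.sum_mul_le_sqrt_mul_sqrt _ _ _
    _ ≤ √(‖k‖ ^ 2) * √(‖h‖ ^ 2) := by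
        gcongr
        · exact P.sum_norm_sq_toFun_le k hS hd
        · exact P.sum_norm_sq_toFun_le h hS hd
    _ = ‖k‖ * ‖h‖ := by rw [Real.sqrt_sq (norm_nonneg _), Real.sqrt_sq (norm_nonneg _)]

theorem norm_cintegral_scalarMeasure_le (P : SpectralMeasure α H) (k h : H) {g : α → ℂ} {C : ℝ}
    (hC0 : 0 ≤ C) (hC : ∀ x, ‖g x‖ ≤ C) :
    ‖(P.scalarMeasure k h).cintegral g‖ ≤ C * ‖k‖ * ‖h‖ := by
  refine (ComplexMeasure.norm_cintegral_le _ hC).trans ?_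
  rw [mul_assoc]
  gcongr
  exact ENNReal.toReal_le_of_le_ofReal (by positivity) (P.variation_scalarMeasure_le k h)

theorem scalarMeasure_add_left (P : SpectralMeasure α H) (k k' h : H) :
    P.scalarMeasure (k + k') h = P.scalarMeasure k h + P.scalarMeasure k' h := by
  ext s hs
  simp [scalarMeasure_apply, hs]

theorem scalarMeasure_add_right (P : SpectralMeasure α H) (k h h' : H) :
    P.scalarMeasure k (h + h') = P.scalarMeasure k h + P.scalarMeasure k h' := by
  ext s hs
  simp [scalarMeasure_apply, hs]

theorem exists_integral (P : SpectralMeasure α H) {g : α → ℂ} (hg : Measurable g)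
    (hC : ∃ C, ∀ x, ‖g x‖ ≤ C) :
    ∃ A : H →L[ℂ] H, ∀ k h, inner ℂ k (A h) = (P.scalarMeasure k h).cintegral g := by
  obtain ⟨C, hC⟩ := hC
  have hi := fun k h => (P.scalarMeasure k h).integrable_of_bounded hg hC
  let B₀ : H →ₗ⋆[ℂ] H →ₗ[ℂ] ℂ := LinearMap.mk₂'ₛₗ _ _
    (fun k h => (P.scalarMeasure k h).cintegral g)
    (fun k k' h => by
      rw [scalarMeasure_add_left]
      exact VectorMeasure.integral_add_vectorMeasure (hi _ _) (hi _ _))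
    (fun c k h => ComplexMeasure.cintegral_smul_measure _ _ _ (fun s hs => by
      rw [scalarMeasure_apply _ _ _ hs, scalarMeasure_apply _ _ _ hs, inner_smul_left]) hg hC)
    (fun k h h' => by
      rw [scalarMeasure_add_right]
      exact VectorMeasure.integral_add_vectorMeasure (hi _ _) (hi _ _))
    (fun c k h => ComplexMeasure.cintegral_smul_measure _ _ _ (fun s hs => by
      rw [scalarMeasure_apply _ _ _ hs, scalarMeasure_apply _ _ _ hs, map_smul, inner_smul_right]
      rfl) hg hC)
  let B : H →L⋆[ℂ] H →L[ℂ] ℂ := B₀.mkContinuous₂ |C| fun k h =>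
    P.norm_cintegral_scalarMeasure_le k h (abs_nonneg C) fun x => (hC x).trans (le_abs_self C)
  refine ⟨ContinuousLinearMap.adjoint (InnerProductSpace.continuousLinearMapOfBilin B),
    fun k h => ?_⟩
  rw [ContinuousLinearMap.adjoint_inner_right, InnerProductSpace.continuousLinearMapOfBilin_apply]
  rfl

open scoped Classical in
/-- The operator `∫ g dP`, for `g` bounded and measurable; by convention it is `0` for other
functions. It is determined by `⟪k, (∫ g dP) h⟫ = ∫ g d⟪k, P(·) h⟫`. -/
def integral (P : SpectralMeasure α H) (g : α → ℂ) : H →L[ℂ] H :=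
  if hg : Measurable g ∧ ∃ C, ∀ x, ‖g x‖ ≤ C then (P.exists_integral hg.1 hg.2).choose else 0

theorem inner_integral (P : SpectralMeasure α H) {g : α → ℂ} (hg : Measurable g) {C : ℝ}
    (hC : ∀ x, ‖g x‖ ≤ C) (k h : H) :
    inner ℂ k (P.integral g h) = (P.scalarMeasure k h).cintegral g := by
  have hgC : Measurable g ∧ ∃ C, ∀ x, ‖g x‖ ≤ C := ⟨hg, C, hC⟩
  rw [integral, dif_pos hgC]
  exact (P.exists_integral hgC.1 hgC.2).choose_spec k h

theorem norm_integral_le (P : SpectralMeasure α H) {g : α → ℂ} (hg : Measurable g) {C : ℝ}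
    (hC0 : 0 ≤ C) (hC : ∀ x, ‖g x‖ ≤ C) : ‖P.integral g‖ ≤ C := by
  refine ContinuousLinearMap.opNorm_le_bound _ hC0 fun h => ?_
  have h1 : ‖inner ℂ (P.integral g h) (P.integral g h)‖ ≤ C * ‖P.integral g h‖ * ‖h‖ := by
    conv_lhs => rw [P.inner_integral hg hC]
    exact P.norm_cintegral_scalarMeasure_le _ _ hC0 hC
  rw [inner_self_eq_norm_sq_to_K] at h1
  have h2 : ‖P.integral g h‖ ^ 2 ≤ C * ‖P.integral g h‖ * ‖h‖ := by simpa using h1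
  rcases (norm_nonneg (P.integral g h)).eq_or_lt with h0 | h0
  · rw [← h0]; positivity
  · nlinarith

theorem integral_indicator (P : SpectralMeasure α H) (c : ℂ) {s : Set α} (hs : MeasurableSet s) :
    P.integral (s.indicator fun _ => c) = c • P.toFun s := by
  ext h
  refine ext_inner_left ℂ fun k => ?_
  rw [P.inner_integral (C := ‖c‖) (measurable_const.indicator hs)
    (fun x => norm_indicator_le_norm_self (fun _ => c) x),
    ComplexMeasure.cintegral_indicator _ _ hs, scalarMeasure_apply _ _ _ hs,
    _root_.smul_apply, inner_smul_right]

theorem integral_add (P : SpectralMeasure α H) {f g : α → ℂ} (hf : Measurable f)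
    (hg : Measurable g) (hfC : ∃ C, ∀ x, ‖f x‖ ≤ C) (hgC : ∃ C, ∀ x, ‖g x‖ ≤ C) :
    P.integral (f + g) = P.integral f + P.integral g := by
  obtain ⟨C, hC⟩ := hfC
  obtain ⟨D, hD⟩ := hgC
  ext h
  refine ext_inner_left ℂ fun k => ?_
  rw [P.inner_integral (hf.add hg) (C := C + D)
    (fun x => (norm_add_le _ _).trans (add_le_add (hC x) (hD x))),
    ComplexMeasure.cintegral_add _ hf hg ⟨C, hC⟩ ⟨D, hD⟩, _root_.add_apply,
    inner_add_right, P.inner_integral hf hC, P.inner_integral hg hD]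

theorem tendsto_inner_integral (P : SpectralMeasure α H) {F : ℕ → α → ℂ} {f : α → ℂ} {C : ℝ}
    (hF : ∀ n, Measurable (F n)) (hf : Measurable f) (hC : ∀ n x, ‖F n x‖ ≤ C)
    (hfC : ∀ x, ‖f x‖ ≤ C)
    (hlim : ∀ x, Filter.Tendsto (fun n => F n x) Filter.atTop (nhds (f x))) (k h : H) :
    Filter.Tendsto (fun n => inner ℂ k (P.integral (F n) h)) Filter.atTop
      (nhds (inner ℂ k (P.integral f h))) := by
  rw [P.inner_integral hf hfC]
  simp_rw [fun n => P.inner_integral (hF n) (hC n)]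
  exact ComplexMeasure.tendsto_cintegral _ hF hC hlim

end SpectralMeasure

/-! ### Singular values and finite rank operators -/

section SingularValues

variable {H : Type*} [NormedAddCommGroup H] [InnerProductSpace ℂ H]

theorem singularValue_index_zero (T : H →L[ℂ] H) : singularValue T 0 = ‖T‖ := by
  refine le_antisymm (by simpa using singularValue_le T 0 0 (by simp)) ?_
  refine le_of_forall_pos_le_add fun ε hε => ?_
  obtain ⟨F, hF, hlt⟩ := exists_norm_sub_lt T 0 hε
  have h0 : (F : H →ₗ[ℂ] H) = 0 := by
    have h1 : LinearMap.rank (F : H →ₗ[ℂ] H) = 0 := le_antisymm (by simpa using hF) zero_le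
    exact LinearMap.range_eq_bot.1 (Submodule.rank_eq_zero.1 h1)
  have : F = 0 := by ext x; exact congrArg (fun A : H →ₗ[ℂ] H => A x) h0
  rw [this, sub_zero] at hlt
  exact hlt.le

theorem singularValue_eq_zero_of_rank_le {F : H →L[ℂ] H} {r n : ℕ}
    (hF : LinearMap.rank (F : H →ₗ[ℂ] H) ≤ (r : Cardinal)) (hn : r ≤ n) :
    singularValue F n = 0 :=
  le_antisymm (by simpa using singularValue_le F F n (hF.trans (by exact_mod_cast hn)))
    (singularValue_nonneg _ _)

theorem singularValue_sub_le_of_rank_le (T : H →L[ℂ] H) {F : H →L[ℂ] H} {r : ℕ}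
    (hF : LinearMap.rank (F : H →ₗ[ℂ] H) ≤ (r : Cardinal)) (n : ℕ) :
    singularValue (T - F) (n + r) ≤ singularValue T n := by
  have h := singularValue_add_le T ((-1 : ℂ) • F) n r
  have h1 := singularValue_smul_le (-1) F r
  rw [singularValue_eq_zero_of_rank_le hF le_rfl, mul_zero] at h1
  have h2 : T + (-1 : ℂ) • F = T - F := by rw [neg_smul, one_smul, sub_eq_add_neg]
  rw [h2] at h
  linarith

theorem rank_comp_comp_le (A F B : H →L[ℂ] H) :
    LinearMap.rank ((A ∘L F ∘L B : H →L[ℂ] H) : H →ₗ[ℂ] H) ≤ LinearMap.rank (F : H →ₗ[ℂ] H) :=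
  (LinearMap.rank_comp_le_right ((F : H →ₗ[ℂ] H).comp (B : H →ₗ[ℂ] H)) (A : H →ₗ[ℂ] H)).trans
    (LinearMap.rank_comp_le_left (B : H →ₗ[ℂ] H) (F : H →ₗ[ℂ] H))

theorem singularValue_comp_comp_le {A B : H →L[ℂ] H} (hA : ‖A‖ ≤ 1) (hB : ‖B‖ ≤ 1)
    (T : H →L[ℂ] H) (n : ℕ) : singularValue (A ∘L T ∘L B) n ≤ singularValue T n := by
  refine le_of_forall_pos_le_add fun ε hε => ?_
  obtain ⟨F, hF, hlt⟩ := exists_norm_sub_lt T n hε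
  refine (singularValue_le _ (A ∘L F ∘L B) n ((rank_comp_comp_le A F B).trans hF)).trans ?_
  have h1 : A ∘L T ∘L B - A ∘L F ∘L B = A ∘L (T - F) ∘L B := by ext x; simp
  rw [h1]
  calc ‖A ∘L (T - F) ∘L B‖ ≤ ‖A‖ * (‖T - F‖ * ‖B‖) :=
        (ContinuousLinearMap.opNorm_comp_le _ _).trans
          (mul_le_mul_of_nonneg_left (ContinuousLinearMap.opNorm_comp_le _ _) (norm_nonneg _))
    _ ≤ 1 * (‖T - F‖ * 1) := by gcongr
    _ ≤ singularValue T n + ε := by linarith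

theorem memSchatten_of_rank_le {F : H →L[ℂ] H} {r : ℕ}
    (hF : LinearMap.rank (F : H →ₗ[ℂ] H) ≤ (r : Cardinal)) {p : ℝ} (hp : 1 ≤ p) :
    MemSchatten p F := by
  refine summable_of_ne_finset_zero (s := Finset.range r) fun n hn => ?_
  rw [singularValue_eq_zero_of_rank_le hF (by simpa using hn), Real.zero_rpow (by linarith)]

theorem norm_le_schattenNorm {p : ℝ} (hp : 1 ≤ p) {T : H →L[ℂ] H} (hT : MemSchatten p T) :
    ‖T‖ ≤ schattenNorm p T := by
  have hp0 : 0 < p := by linarith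
  rw [← singularValue_index_zero, schattenNorm, one_div]
  refine (Real.le_rpow_inv_iff_of_pos (singularValue_nonneg _ _) (tsum_nonneg fun n =>
    Real.rpow_nonneg (singularValue_nonneg _ _) p) hp0).2 ?_
  exact hT.le_tsum 0 fun n _ => Real.rpow_nonneg (singularValue_nonneg _ _) p

/-- Finite rank operators are dense in the Schatten classes. -/
theorem exists_schattenNorm_sub_lt {p : ℝ} (hp : 1 ≤ p) {T : H →L[ℂ] H} (hT : MemSchatten p T)
    {ε : ℝ} (hε : 0 < ε) :
    ∃ (F : H →L[ℂ] H) (r : ℕ), LinearMap.rank (F : H →ₗ[ℂ] H) ≤ (r : Cardinal) ∧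
      schattenNorm p (T - F) < ε := by
  have hp0 : 0 < p := by linarith
  have ha0 : ∀ n, 0 ≤ singularValue T n ^ p := fun n =>
    Real.rpow_nonneg (singularValue_nonneg _ _) p
  have ha : Antitone fun n => singularValue T n ^ p := fun m n hmn =>
    Real.rpow_le_rpow (singularValue_nonneg _ _) (singularValue_antitone T hmn) hp0.le
  set a : ℕ → ℝ := fun n => singularValue T n ^ p with ha_def
  have hT' : Summable a := hT
  -- `F` approximates `T` up to rank `2 * m`; the first `4 * m` singular values of `T - F` are then
  -- bounded by `‖T - F‖`, the later ones by those of `T` with index shifted by `3 * m`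
  set η : ℝ := ε ^ p / 6 with hη_def
  have hη : 0 < η := by positivity
  obtain ⟨m, hm⟩ := ((tendsto_sum_nat_add a).eventually (gt_mem_nhds hη)).exists
  have hsum_m : Summable fun k => a (k + m) := (summable_nat_add_iff m).2 hT'
  -- monotonicity bounds `m * a (2 * m)` by the tail of the series
  have hmid : m * a (2 * m) ≤ ∑' k, a (k + m) := by
    calc (m : ℝ) * a (2 * m) = ∑ _k ∈ Finset.range m, a (2 * m) := by simp
      _ ≤ ∑ k ∈ Finset.range m, a (k + m) := Finset.sum_le_sum fun k hk =>
          ha (by have := Finset.mem_range.1 hk; omega)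
      _ ≤ ∑' k, a (k + m) := hsum_m.sum_le_tsum _ fun k _ => ha0 _
  set η' : ℝ := η / (4 * m + 1) with hη'_def
  have hη' : 0 < η' := by positivity
  have hlt : singularValue T (2 * m) < (a (2 * m) + η') ^ (1 / p) := by
    rw [one_div]
    exact (Real.lt_rpow_inv_iff_of_pos (singularValue_nonneg _ _)
      (add_nonneg (ha0 _) hη'.le) hp0).2 (lt_add_of_pos_right _ hη')
  obtain ⟨F, hF, hTF⟩ := exists_norm_sub_lt T (2 * m) (sub_pos.2 hlt)
  rw [add_sub_cancel] at hTF
  refine ⟨F, 2 * m, hF, ?_⟩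
  set b : ℕ → ℝ := fun n => singularValue (T - F) n ^ p with hb_def
  have hb1 : ∀ n, b n ≤ a (2 * m) + η' := fun n => by
    have h1 : singularValue (T - F) n ≤ (a (2 * m) + η') ^ (1 / p) :=
      (singularValue_antitone _ (zero_le (a := n))).trans
        ((singularValue_index_zero (T - F)).le.trans hTF.le)
    refine (Real.rpow_le_rpow (singularValue_nonneg _ _) h1 hp0.le).trans ?_
    rw [← Real.rpow_mul (add_nonneg (ha0 _) hη'.le), one_div, inv_mul_cancel₀ hp0.ne',
      Real.rpow_one]
  have hb2 : ∀ n, b (n + 4 * m) ≤ a (n + m) := fun n => by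
    have h1 := singularValue_sub_le_of_rank_le T hF (n + 2 * m)
    rw [show n + 2 * m + 2 * m = n + 4 * m by ring] at h1
    exact (Real.rpow_le_rpow (singularValue_nonneg _ _) h1 hp0.le).trans (ha (by omega))
  have hb0 : ∀ n, 0 ≤ b n := fun n => Real.rpow_nonneg (singularValue_nonneg _ _) p
  have hbs : Summable fun n => b (n + 4 * m) := Summable.of_nonneg_of_le (fun n => hb0 _) hb2 hsum_m
  have hbt : ∑' n, b n < ε ^ p := by
    rw [← Summable.sum_add_tsum_nat_add (4 * m) ((summable_nat_add_iff (4 * m)).1 hbs)]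
    have h1 : ∑ n ∈ Finset.range (4 * m), b n ≤ 4 * m * (a (2 * m) + η') := by
      refine (Finset.sum_le_sum fun n _ => hb1 n).trans ?_
      simp [mul_add]
    have h2 : ∑' n, b (n + 4 * m) ≤ ∑' n, a (n + m) := hbs.tsum_le_tsum hb2 hsum_m
    have h3 : 4 * m * η' ≤ η := by
      rw [hη'_def, mul_div_assoc', div_le_iff₀ (by positivity)]
      nlinarith
    have h4 : ε ^ p = 6 * η := by rw [hη_def]; ring
    nlinarith
  calc schattenNorm p (T - F) = (∑' n, b n) ^ (1 / p) := rfl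
    _ < (ε ^ p) ^ (1 / p) := Real.rpow_lt_rpow (tsum_nonneg hb0) hbt (by positivity)
    _ = ε := by rw [one_div, Real.rpow_rpow_inv hε.le hp0.ne']

/-- A trace class operator is a series of finite rank operators. If `F k` has rank at most `2 ^ k`
and is nearly optimal, then `F (k + 1) - F k` has rank at most `3 * 2 ^ k` and norm about
`2 * s_{2 ^ k}(T)`, and `∑ 2 ^ k * s_{2 ^ k}(T)` converges by Cauchy condensation. -/
theorem MemSchatten.exists_tendsto_sum_finiteRank {T : H →L[ℂ] H} (hT : MemSchatten 1 T) :
    ∃ D : ℕ → (H →L[ℂ] H),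
      (∀ k, LinearMap.rank (D k).toLinearMap ≤ ((2 ^ (k + 1) : ℕ) : Cardinal)) ∧
      Summable (fun k => (2 : ℝ) ^ (k + 1) * ‖D k‖) ∧
      ∀ x, Filter.Tendsto (fun n => ∑ k ∈ Finset.range n, D k x) Filter.atTop (nhds (T x)) := by
  have hs : Summable (singularValue T) := by simpa [MemSchatten] using hT
  have hcond : Summable fun k : ℕ => (2 : ℝ) ^ k * singularValue T (2 ^ k) :=
    (summable_condensed_iff_of_nonneg (singularValue_nonneg T)
      fun m n _ hmn => singularValue_antitone T hmn).2 hs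
  choose F hFr hFn using fun k : ℕ =>
    exists_norm_sub_lt T (2 ^ k) (ε := (1 / 4) ^ k) (by positivity)
  let D : ℕ → H →L[ℂ] H := fun k => Nat.casesOn k (F 0) fun k => F (k + 1) - F k
  have hDr : ∀ k, LinearMap.rank (D k).toLinearMap ≤ ((2 ^ (k + 1) : ℕ) : Cardinal) := by
    rintro (_ | k)
    · exact (hFr 0).trans (by norm_num)
    · have h1 : (D (k + 1)).toLinearMap = (F (k + 1) : H →ₗ[ℂ] H) +
          (-LinearMap.id).comp (F k : H →ₗ[ℂ] H) := by
        ext x; simp [D, sub_eq_add_neg]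
      rw [h1]
      refine (LinearMap.rank_add_le _ _).trans ((add_le_add (hFr (k + 1))
        ((LinearMap.rank_comp_le_right _ _).trans (hFr k))).trans ?_)
      norm_cast
      rw [pow_succ 2 (k + 1), pow_succ 2 k]
      omega
  have hDn : Summable fun k => (2 : ℝ) ^ (k + 1) * ‖D k‖ := by
    rw [← summable_nat_add_iff 1]
    have h1 : Summable fun k : ℕ => 8 * ((2 : ℝ) ^ k * singularValue T (2 ^ k)) + 8 * (1 / 2) ^ k :=
      (hcond.mul_left 8).add (summable_geometric_two.mul_left 8)
    refine Summable.of_nonneg_of_le (fun k => by positivity) (fun k => ?_) h1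
    have h2 : ‖D (k + 1)‖ ≤ 2 * (singularValue T (2 ^ k) + (1 / 4) ^ k) := by
      have h3 : D (k + 1) = (T - F k) - (T - F (k + 1)) := by simp [D]
      have h4 : singularValue T (2 ^ (k + 1)) ≤ singularValue T (2 ^ k) :=
        singularValue_antitone T (Nat.pow_le_pow_right (by norm_num) (Nat.le_succ k))
      have h5 : ((1 : ℝ) / 4) ^ (k + 1) ≤ (1 / 4) ^ k :=
        pow_le_pow_of_le_one (by norm_num) (by norm_num) (Nat.le_succ k)
      rw [h3]
      linarith [norm_sub_le (T - F k) (T - F (k + 1)), hFn k, hFn (k + 1)]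
    have h6 : (2 : ℝ) ^ k * (1 / 4) ^ k = (1 / 2) ^ k := by rw [← mul_pow]; norm_num
    calc (2 : ℝ) ^ (k + 1 + 1) * ‖D (k + 1)‖
        ≤ 2 ^ (k + 1 + 1) * (2 * (singularValue T (2 ^ k) + (1 / 4) ^ k)) := by gcongr
      _ = 8 * (2 ^ k * singularValue T (2 ^ k)) + 8 * (2 ^ k * (1 / 4) ^ k) := by ring
      _ = _ := by rw [h6]
  refine ⟨D, hDr, hDn, fun x => (Filter.tendsto_add_atTop_iff_nat 1).1 ?_⟩
  have h2 : ∀ n, ∑ k ∈ Finset.range (n + 1), D k x = F n x := by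
    intro n
    induction n with
    | zero => simp [D]
    | succ n ih => rw [Finset.sum_range_succ, ih]; simp [D]
  have h3 : Filter.Tendsto F Filter.atTop (nhds T) := by
    rw [tendsto_iff_norm_sub_tendsto_zero]
    have h4 : Filter.Tendsto (fun k => singularValue T (2 ^ k) + (1 / 4 : ℝ) ^ k) Filter.atTop
        (nhds (0 + 0)) :=
      (hs.tendsto_atTop_zero.comp (tendsto_pow_atTop_atTop_of_one_lt (by norm_num))).add
        (tendsto_pow_atTop_nhds_zero_of_lt_one (by norm_num) (by norm_num))
    rw [add_zero] at h4
    refine squeeze_zero (fun _ => norm_nonneg _) (fun k => ?_) h4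
    rw [norm_sub_rev]
    exact (hFn k).le
  simp only [h2]
  exact ((ContinuousLinearMap.apply ℂ H x).continuous.tendsto T).comp h3

end SingularValues

section FiniteRank

variable {H : Type*} [NormedAddCommGroup H] [InnerProductSpace ℂ H] [CompleteSpace H]

open ContinuousLinearMap (adjoint)

/-- An operator of rank at most `r` is a sum of `r` operators `⟪u, ·⟫ v` of rank one, with
`‖u‖² ≤ ‖D‖` and `‖v‖² ≤ ‖D‖`: take for the `v` an orthonormal basis of the range, rescaled. -/
theorem exists_eq_sum_rankOne {D : H →L[ℂ] H} {r : ℕ}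
    (hD : LinearMap.rank (D : H →ₗ[ℂ] H) ≤ (r : Cardinal)) :
    ∃ u v : ℕ → H, (∀ i, ‖u i‖ ^ 2 ≤ ‖D‖) ∧ (∀ i, ‖v i‖ ^ 2 ≤ ‖D‖) ∧
      (∀ i, r ≤ i → u i = 0) ∧ (∀ i, r ≤ i → v i = 0) ∧
      ∀ x, D x = ∑ i ∈ Finset.range r, inner ℂ (u i) x • v i := by
  have : FiniteDimensional ℂ (LinearMap.range (D : H →ₗ[ℂ] H)) :=
    Module.rank_lt_aleph0_iff.1 (hD.trans_lt Cardinal.natCast_lt_aleph0)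
  have hq : Module.finrank ℂ (LinearMap.range (D : H →ₗ[ℂ] H)) ≤ r :=
    Module.finrank_le_of_rank_le hD
  set q := Module.finrank ℂ (LinearMap.range (D : H →ₗ[ℂ] H))
  let b := stdOrthonormalBasis ℂ (LinearMap.range (D : H →ₗ[ℂ] H))
  let w : ℕ → H := fun i => if h : i < q then (b ⟨i, h⟩ : H) else 0
  have hw : ∀ i, ‖w i‖ ≤ 1 := by
    intro i
    by_cases h : i < q
    · simp only [w, h, dif_pos]
      exact (b.orthonormal.1 ⟨i, h⟩).le
    · simp [w, h]
  have hw0 : ∀ i, r ≤ i → w i = 0 := fun i hi => by simp [w, not_lt.2 (hq.trans hi)]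
  have hDx : ∀ x, D x = ∑ i ∈ Finset.range r, inner ℂ (w i) (D x) • w i := by
    intro x
    have h1 : (⟨D x, x, rfl⟩ : LinearMap.range (D : H →ₗ[ℂ] H)) =
        ∑ i, inner ℂ (b i) ⟨D x, x, rfl⟩ • b i := (b.sum_repr' _).symm
    have h2 : D x = ∑ i : Fin q, inner ℂ (b i : H) (D x) • (b i : H) := by
      have := congrArg (Subtype.val) h1
      simpa using this
    rw [← Finset.sum_subset (Finset.range_subset_range.2 hq), ← Fin.sum_univ_eq_sum_range
      (fun i => inner ℂ (w i) (D x) • w i)]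
    · conv_lhs => rw [h2]
      refine Finset.sum_congr rfl fun i _ => ?_
      simp [w]
    · intro i _ hi
      have : w i = 0 := by simp only [w, Finset.mem_range] at hi ⊢; simp [hi]
      simp [this]
  set d := ‖D‖ with hd
  rcases (norm_nonneg D).eq_or_lt with h0 | h0
  · refine ⟨0, 0, by simp [hd], by simp [hd], by simp, by simp, fun x => ?_⟩
    have : D = 0 := norm_eq_zero.1 h0.symm
    simp [this]
  have hs : 0 < √d := Real.sqrt_pos.2 h0
  have hss : √d * √d = d := Real.mul_self_sqrt h0.le
  refine ⟨fun i => ((√d)⁻¹ : ℂ) • adjoint D (w i), fun i => ((√d : ℝ) : ℂ) • w i, fun i => ?_,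
    fun i => ?_, fun i hi => by simp [hw0 i hi], fun i hi => by simp [hw0 i hi], fun x => ?_⟩
  · have h1 : ‖adjoint D (w i)‖ ≤ d := by
      refine ((adjoint D).le_opNorm _).trans ?_
      rw [LinearIsometryEquiv.norm_map]
      exact mul_le_of_le_one_right h0.le (hw i)
    have h2 : ‖((√d)⁻¹ : ℂ) • adjoint D (w i)‖ ≤ √d := by
      rw [norm_smul, norm_inv, Complex.norm_real, Real.norm_of_nonneg hs.le,
        inv_mul_le_iff₀ hs, hss]
      exact h1
    calc _ ≤ (√d) ^ 2 := by gcongr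
      _ = d := Real.sq_sqrt h0.le
  · have h2 : ‖((√d : ℝ) : ℂ) • w i‖ ≤ √d := by
      rw [norm_smul, Complex.norm_real, Real.norm_of_nonneg hs.le]
      exact mul_le_of_le_one_right hs.le (hw i)
    calc _ ≤ (√d) ^ 2 := by gcongr
      _ = d := Real.sq_sqrt h0.le
  · rw [hDx x]
    refine Finset.sum_congr rfl fun i _ => ?_
    have h3 : (√d : ℂ) ≠ 0 := by exact_mod_cast hs.ne'
    rw [inner_smul_left, ContinuousLinearMap.adjoint_inner_left, smul_smul, map_inv₀,
      Complex.conj_ofReal, mul_comm, ← mul_assoc, mul_inv_cancel₀ h3, one_mul]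

/-- A trace class operator is an absolutely convergent sum of operators `⟪u, ·⟫ v` of rank one. -/
theorem MemSchatten.exists_hasSum_rankOne {T : H →L[ℂ] H} (hT : MemSchatten 1 T) :
    ∃ u v : ℕ → H, Summable (fun n => ‖u n‖ ^ 2) ∧ Summable (fun n => ‖v n‖ ^ 2) ∧
      ∀ x, HasSum (fun n => inner ℂ (u n) x • v n) (T x) := by
  obtain ⟨D, hDr, hDn, hDT⟩ := hT.exists_tendsto_sum_finiteRank
  choose u v hu hv hu0 hv0 huv using fun k => exists_eq_sum_rankOne (hDr k)
  have hl2 : ∀ w : ℕ → ℕ → H, (∀ k i, ‖w k i‖ ^ 2 ≤ ‖D k‖) → (∀ k i, 2 ^ (k + 1) ≤ i → w k i = 0) →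
      Summable fun z : ℕ × ℕ => ‖w z.1 z.2‖ ^ 2 := by
    intro w hw hw0
    have hfin : ∀ k, ∀ i ∉ Finset.range (2 ^ (k + 1)), ‖w k i‖ ^ 2 = 0 := fun k i hi => by
      rw [hw0 k i (by simpa using hi)]; simp
    rw [summable_prod_of_nonneg fun z => by positivity]
    refine ⟨fun k => summable_of_ne_finset_zero (hfin k), ?_⟩
    refine Summable.of_nonneg_of_le (fun k => tsum_nonneg fun i => by positivity) (fun k => ?_) hDn
    rw [tsum_eq_sum (hfin k)]
    refine (Finset.sum_le_sum fun i _ => hw k i).trans ?_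
    simp
  have hu2 := hl2 u hu hu0
  have hv2 := hl2 v hv hv0
  let e : ℕ ≃ ℕ × ℕ := Nat.pairEquiv.symm
  refine ⟨fun n => u (e n).1 (e n).2, fun n => v (e n).1 (e n).2,
    (e.summable_iff (f := fun z : ℕ × ℕ => ‖u z.1 z.2‖ ^ 2)).2 hu2,
    (e.summable_iff (f := fun z : ℕ × ℕ => ‖v z.1 z.2‖ ^ 2)).2 hv2, fun x => ?_⟩
  refine (e.hasSum_iff (f := fun z : ℕ × ℕ => inner ℂ (u z.1 z.2) x • v z.1 z.2)).2 ?_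
  have hsum : Summable fun z : ℕ × ℕ => inner ℂ (u z.1 z.2) x • v z.1 z.2 := by
    refine Summable.of_norm_bounded ((hu2.add hv2).mul_left ‖x‖) fun z => ?_
    rw [norm_smul]
    calc _ ≤ (‖u z.1 z.2‖ * ‖x‖) * ‖v z.1 z.2‖ := by gcongr; exact norm_inner_le_norm _ _
      _ = ‖x‖ * (‖u z.1 z.2‖ * ‖v z.1 z.2‖) := by ring
      _ ≤ _ := by
        gcongr
        nlinarith [sq_nonneg (‖u z.1 z.2‖ - ‖v z.1 z.2‖), sq_nonneg ‖u z.1 z.2‖,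
          sq_nonneg ‖v z.1 z.2‖]
  have hfib : ∀ k, HasSum (fun i => inner ℂ (u k i) x • v k i) (D k x) := fun k => by
    rw [huv k x]
    exact hasSum_sum_of_ne_finset_zero fun i hi => by rw [hv0 k i (by simpa using hi), smul_zero]
  have h1 := (hsum.hasSum.prod_fiberwise hfib).tendsto_sum_nat
  rw [tendsto_nhds_unique (hDT x) h1]
  exact hsum.hasSum

end FiniteRank

/-! ### The complex measures of a trace class operator -/

/-- The sum of a series of complex measures, dominated by a convergent series of constants. -/
theorem MeasureTheory.ComplexMeasure.exists_hasSum {X : Type*} [MeasurableSpace X]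
    {ρ : ℕ → ComplexMeasure X} {b : ℕ → ℝ} (hb : Summable b) (hρ : ∀ n s, ‖ρ n s‖ ≤ b n) :
    ∃ m : ComplexMeasure X, ∀ s, HasSum (fun n => ρ n s) (m s) := by
  have hs : ∀ s, Summable fun n => ρ n s := fun s => Summable.of_norm_bounded hb fun n => hρ n s
  refine ⟨⟨fun s => ∑' n, ρ n s, by simp, fun s hs => ?_, fun E hE hd => ?_⟩,
    fun s => (hs s).hasSum⟩
  · simp [VectorMeasure.not_measurable _ hs]
  · have h1 : ∀ S : Finset ℕ, ∑ i ∈ S, ∑' n, ρ n (E i) = ∑' n, ρ n (⋃ i ∈ S, E i) := fun S => by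
      rw [← Summable.tsum_finsetSum fun i _ => hs _]
      congr 1 with n
      rw [VectorMeasure.of_biUnion_finset (fun i _ j _ hij => hd hij) fun i _ => hE i]
    have h2 : Filter.Tendsto (fun S : Finset ℕ => ∑' n, ρ n (⋃ i ∈ S, E i)) Filter.atTop
        (nhds (∑' n, ρ n (⋃ i, E i))) := by
      refine tendsto_tsum_of_dominated_convergence hb (fun n => ?_)
        (Filter.Eventually.of_forall fun S n => hρ n _)
      refine ((ρ n).m_iUnion hE hd).congr' (Filter.Eventually.of_forall fun S => ?_)
      exact (VectorMeasure.of_biUnion_finset (fun i _ j _ hij => hd hij) fun i _ => hE i).symm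
    exact h2.congr fun S => (h1 S).symm

section TraceClass

variable {α β : Type*} [MeasurableSpace α] [MeasurableSpace β]
variable {H : Type*} [NormedAddCommGroup H] [InnerProductSpace ℂ H] [CompleteSpace H]

theorem norm_prod_scalarMeasure_le (P : SpectralMeasure α H) (Q : SpectralMeasure β H)
    (k v u h : H) (s : Set (α × β)) :
    ‖(P.scalarMeasure k v).prod (Q.scalarMeasure u h) (ContinuousLinearMap.mul ℝ ℂ) s‖ ≤
      ‖k‖ * ‖v‖ * (‖u‖ * ‖h‖) := by
  have h1 := VectorMeasure.variation_prod_le (μ := P.scalarMeasure k v)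
    (ν := Q.scalarMeasure u h) (B := ContinuousLinearMap.mul ℝ ℂ)
  have h2 : ‖(P.scalarMeasure k v).prod (Q.scalarMeasure u h) (ContinuousLinearMap.mul ℝ ℂ) s‖ₑ ≤
      ENNReal.ofReal (‖k‖ * ‖v‖ * (‖u‖ * ‖h‖)) := by
    refine (VectorMeasure.enorm_measure_le_variation _ _).trans ((measure_mono
      (Set.subset_univ s)).trans ((h1 _).trans ?_))
    have h3 : ‖ContinuousLinearMap.mul ℝ ℂ‖ₑ ≤ 1 := by
      rw [← ofReal_norm, ← ENNReal.ofReal_one]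
      exact ENNReal.ofReal_le_ofReal (ContinuousLinearMap.opNorm_mul_le ℝ ℂ)
    rw [Measure.smul_apply, smul_eq_mul, ← Set.univ_prod_univ, Measure.prod_prod,
      ENNReal.ofReal_mul (by positivity)]
    calc _ ≤ 1 * (ENNReal.ofReal (‖k‖ * ‖v‖) * ENNReal.ofReal (‖u‖ * ‖h‖)) := by
          gcongr
          · exact P.variation_scalarMeasure_le k v
          · exact Q.variation_scalarMeasure_le u h
      _ = _ := one_mul _
  rw [← ofReal_norm] at h2
  exact (ENNReal.ofReal_le_ofReal_iff (by positivity)).1 h2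

/-- For a trace class operator `T`, the set function `E × F ↦ ⟪k, P(E) T Q(F) h⟫` extends to a
complex measure: a sum of products of complex measures, one for each rank one term of `T`. -/
theorem MemSchatten.exists_complexMeasure {T : H →L[ℂ] H} (hT : MemSchatten 1 T)
    (P : SpectralMeasure α H) (Q : SpectralMeasure β H) (h k : H) :
    ∃ m : ComplexMeasure (α × β), ∀ E F, MeasurableSet E → MeasurableSet F →
      m (E ×ˢ F) = inner ℂ k (P.toFun E (T (Q.toFun F h))) := by
  obtain ⟨u, v, hu, hv, huv⟩ := hT.exists_hasSum_rankOne
  have hb : Summable fun n => ‖k‖ * ‖h‖ * (‖u n‖ ^ 2 + ‖v n‖ ^ 2) := (hu.add hv).mul_left _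
  obtain ⟨m, hm⟩ := ComplexMeasure.exists_hasSum
    (ρ := fun n => (P.scalarMeasure k (v n)).prod (Q.scalarMeasure (u n) h)
      (ContinuousLinearMap.mul ℝ ℂ)) hb fun n s => by
    refine (norm_prod_scalarMeasure_le P Q k (v n) (u n) h s).trans ?_
    calc ‖k‖ * ‖v n‖ * (‖u n‖ * ‖h‖) = ‖k‖ * ‖h‖ * (‖u n‖ * ‖v n‖) := by ring
      _ ≤ _ := by
        gcongr
        nlinarith [sq_nonneg (‖u n‖ - ‖v n‖), sq_nonneg ‖u n‖, sq_nonneg ‖v n‖]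
  refine ⟨m, fun E F hE hF => (hm (E ×ˢ F)).unique ?_⟩
  have h1 := (innerSL ℂ k).hasSum ((P.toFun E).hasSum (huv (Q.toFun F h)))
  refine h1.congr_fun fun n => ?_
  rw [VectorMeasure.prod_apply, P.scalarMeasure_apply _ _ hE, Q.scalarMeasure_apply _ _ hF]
  simp [mul_comm]

theorem complexMeasure_ext {m m' : ComplexMeasure (α × β)}
    (h : ∀ E F, MeasurableSet E → MeasurableSet F → m (E ×ˢ F) = m' (E ×ˢ F)) : m = m' := by
  refine VectorMeasure.ext_of_generateFrom _ ?_ generateFrom_prod.symm isPiSystem_prod ?_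
  · rintro _ ⟨E, hE, F, hF, rfl⟩
    exact h E F hE hF
  · rw [← Set.univ_prod_univ]
    exact h _ _ MeasurableSet.univ MeasurableSet.univ

theorem HasOperatorIntegral.unique {P : SpectralMeasure α H} {Q : SpectralMeasure β H}
    {φ : α × β → ℂ} {T S S' : H →L[ℂ] H} (hS : HasOperatorIntegral P Q φ T S)
    (hS' : HasOperatorIntegral P Q φ T S') : S = S' := by
  ext h
  refine ext_inner_left ℂ fun k => ?_
  obtain ⟨m, hm, -, h1⟩ := hS h k
  obtain ⟨m', hm', -, h2⟩ := hS' h k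
  have : m = m' := complexMeasure_ext fun E F hE hF => by rw [hm E F hE hF, hm' E F hE hF]
  rw [h1, h2, this]

/-- Both sides are determined by their values on indicators, first in `g₁`, then in `g₂`. -/
theorem cintegral_prod_eq_inner {P : SpectralMeasure α H} {Q : SpectralMeasure β H}
    {T : H →L[ℂ] H} {h k : H} {m : ComplexMeasure (α × β)}
    (hm : ∀ E F, MeasurableSet E → MeasurableSet F →
      m (E ×ˢ F) = inner ℂ k (P.toFun E (T (Q.toFun F h))))
    {g₁ : α → ℂ} {g₂ : β → ℂ} (hg₁ : Measurable g₁) (hg₂ : Measurable g₂) {C₁ C₂ : ℝ}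
    (hC₁ : ∀ x, ‖g₁ x‖ ≤ C₁) (hC₂ : ∀ x, ‖g₂ x‖ ≤ C₂) :
    m.cintegral (fun z => g₁ z.1 * g₂ z.2) =
      inner ℂ k (P.integral g₁ (T (Q.integral g₂ h))) := by
  have hprod : ∀ {f : α → ℂ} {g : β → ℂ}, (∃ C, ∀ x, ‖f x‖ ≤ C) → (∃ C, ∀ x, ‖g x‖ ≤ C) →
      ∃ C, ∀ z : α × β, ‖f z.1 * g z.2‖ ≤ C := by
    rintro f g ⟨C, hC⟩ ⟨D, hD⟩
    refine ⟨C * D, fun z => ?_⟩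
    rw [norm_mul]
    exact mul_le_mul (hC _) (hD _) (norm_nonneg _) ((norm_nonneg _).trans (hC z.1))
  have hmeas : ∀ {f : α → ℂ} {g : β → ℂ}, Measurable f → Measurable g →
      Measurable fun z : α × β => f z.1 * g z.2 := fun hf hg =>
    (hf.comp measurable_fst).mul (hg.comp measurable_snd)
  have hind : ∀ {γ : Type _} [MeasurableSpace γ] (c : ℂ) (s : Set γ),
      ∃ C, ∀ x, ‖s.indicator (fun _ => c) x‖ ≤ C := fun c s =>
    ⟨‖c‖, fun x => norm_indicator_le_norm_self (fun _ => c) x⟩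
  refine Measurable.bounded_induction (p := fun g₁ => m.cintegral (fun z => g₁ z.1 * g₂ z.2) =
      inner ℂ k (P.integral g₁ (T (Q.integral g₂ h)))) (fun a s hs => ?_)
    (fun f g hf hg hfC hgC h1 h2 => ?_) (fun F f C hF hf hC hfC hlim ih => ?_) hg₁ hC₁
  · refine Measurable.bounded_induction (p := fun g₂ =>
        m.cintegral (fun z => s.indicator (fun _ => a) z.1 * g₂ z.2) =
        inner ℂ k (P.integral (s.indicator fun _ => a) (T (Q.integral g₂ h)))) (fun b t ht => ?_)
      (fun f g hf hg hfC hgC h1 h2 => ?_) (fun F f C hF hf hC hfC hlim ih => ?_) hg₂ hC₂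
    · have h1 : (fun z : α × β => s.indicator (fun _ => a) z.1 * t.indicator (fun _ => b) z.2) =
          (s ×ˢ t).indicator fun _ => a * b := by
        ext z
        by_cases h1 : z.1 ∈ s <;> by_cases h2 : z.2 ∈ t <;> simp [Set.indicator, h1, h2]
      rw [h1, ComplexMeasure.cintegral_indicator _ _ (hs.prod ht), hm s t hs ht,
        P.integral_indicator a hs, Q.integral_indicator b ht]
      simp only [_root_.smul_apply, map_smul, inner_smul_right]
      ring
    · have h3 : (fun z : α × β => s.indicator (fun _ => a) z.1 * (f + g) z.2) =
          (fun z => s.indicator (fun _ => a) z.1 * f z.2) +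
            fun z => s.indicator (fun _ => a) z.1 * g z.2 := by
        ext z; simp [mul_add]
      have hsm : Measurable (s.indicator fun _ => a) := measurable_const.indicator hs
      rw [h3, ComplexMeasure.cintegral_add _ (hmeas hsm hf)
        (hmeas hsm hg) (hprod (hind a s) hfC)
        (hprod (hind a s) hgC), h1, h2, Q.integral_add hf hg hfC hgC]
      simp only [_root_.add_apply, map_add, inner_add_right]
    · have hsm : Measurable (s.indicator fun _ => a) := measurable_const.indicator hs
      have h1 : Filter.Tendsto (fun n => m.cintegral
          (fun z => s.indicator (fun _ => a) z.1 * F n z.2)) Filter.atTop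
          (nhds (m.cintegral (fun z => s.indicator (fun _ => a) z.1 * f z.2))) := by
        refine ComplexMeasure.tendsto_cintegral m (C := ‖a‖ * C)
          (fun n => hmeas hsm (hF n)) (fun n z => ?_)
          fun z => (hlim z.2).const_mul _
        rw [norm_mul]
        exact mul_le_mul (norm_indicator_le_norm_self (fun _ => a) z.1) (hC n z.2) (norm_nonneg _)
          (norm_nonneg _)
      refine tendsto_nhds_unique h1 ?_
      simp_rw [ih]
      have h2 : ∀ y, inner ℂ k (P.integral (s.indicator fun _ => a) (T y)) = inner ℂ
          (ContinuousLinearMap.adjoint (P.integral (s.indicator fun _ => a) ∘L T) k) y :=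
        fun y => by
        rw [ContinuousLinearMap.adjoint_inner_left]; rfl
      simp_rw [h2]
      exact Q.tendsto_inner_integral hF hf hC hfC hlim _ h
  · have h3 : (fun z : α × β => (f + g) z.1 * g₂ z.2) =
        (fun z => f z.1 * g₂ z.2) + fun z => g z.1 * g₂ z.2 := by
      ext z; simp [add_mul]
    rw [h3, ComplexMeasure.cintegral_add _ (hmeas hf hg₂)
      (hmeas hg hg₂) (hprod hfC ⟨C₂, hC₂⟩)
      (hprod hgC ⟨C₂, hC₂⟩), h1, h2, P.integral_add hf hg hfC hgC]
    simp only [_root_.add_apply, inner_add_right]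
  · have h1 : Filter.Tendsto (fun n => m.cintegral (fun z => F n z.1 * g₂ z.2)) Filter.atTop
        (nhds (m.cintegral (fun z => f z.1 * g₂ z.2))) := by
      refine ComplexMeasure.tendsto_cintegral m (C := C * C₂)
        (fun n => hmeas (hF n) hg₂) (fun n z => ?_)
        fun z => (hlim z.1).mul_const _
      rw [norm_mul]
      exact mul_le_mul (hC n z.1) (hC₂ z.2) (norm_nonneg _) ((norm_nonneg _).trans (hC n z.1))
    refine tendsto_nhds_unique h1 ?_
    simp_rw [ih]
    exact P.tendsto_inner_integral hF hf hC hfC hlim k _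

end TraceClass

/-! ### Ky Fan's variational principle -/

section KyFan

open ContinuousLinearMap (adjoint)

theorem norm_sq_sum_smul_of_orthogonal {ι E : Type*} [NormedAddCommGroup E] [InnerProductSpace ℂ E]
    (s : Finset ι) {z : ι → E} (hz : Pairwise fun i j => inner ℂ (z i) (z j) = 0) (c : ι → ℂ) :
    ‖∑ i ∈ s, c i • z i‖ ^ 2 = ∑ i ∈ s, ‖c i‖ ^ 2 * ‖z i‖ ^ 2 := by
  classical
  induction s using Finset.induction_on with
  | empty => simp
  | insert a s ha ih =>
    rw [Finset.sum_insert ha, Finset.sum_insert ha, ← ih, ← mul_pow, ← norm_smul, sq, sq, sq]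
    refine norm_add_sq_eq_norm_sq_add_norm_sq_of_inner_eq_zero (𝕜 := ℂ) _ _ ?_
    rw [inner_sum]
    refine Finset.sum_eq_zero fun i hi => ?_
    rw [inner_smul_left, inner_smul_right, hz (ne_of_mem_of_not_mem hi ha).symm, mul_zero, mul_zero]

variable {H : Type*} [NormedAddCommGroup H] [InnerProductSpace ℂ H]

/-- A sequence of pairwise orthogonal vectors of norm at most `1`. Vectors that vanish are allowed,
so that such sequences exist in spaces of any dimension. -/
def IsSubOrthonormal (e : ℕ → H) : Prop :=
  (∀ i, ‖e i‖ ≤ 1) ∧ Pairwise fun i j => inner ℂ (e i) (e j) = 0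

theorem IsSubOrthonormal.exists_synthesis {e : ℕ → H} (he : IsSubOrthonormal e) (N : ℕ) :
    ∃ J : EuclideanSpace ℂ (Fin N) →L[ℂ] H, ‖J‖ ≤ 1 ∧
      ∀ i : Fin N, J (EuclideanSpace.single i 1) = e i := by
  let J₀ : EuclideanSpace ℂ (Fin N) →ₗ[ℂ] H :=
    { toFun := fun x => ∑ i : Fin N, x i • e i
      map_add' := fun x y => by simp [add_smul, Finset.sum_add_distrib]
      map_smul' := fun c x => by simp [mul_smul, Finset.smul_sum] }
  have hJ : ∀ x, ‖J₀ x‖ ≤ 1 * ‖x‖ := fun x => by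
    rw [one_mul]
    refine le_of_sq_le_sq ?_ (norm_nonneg _)
    have h1 := norm_sq_sum_smul_of_orthogonal (Finset.univ : Finset (Fin N)) (z := fun i => e i)
      (fun i j hij => he.2 fun h => hij (Fin.ext h)) x
    rw [EuclideanSpace.norm_sq_eq]
    refine h1.le.trans (Finset.sum_le_sum fun i _ => ?_)
    exact mul_le_of_le_one_right (by positivity) (pow_le_one₀ (norm_nonneg _) (he.1 i))
  refine ⟨J₀.mkContinuous 1 hJ, J₀.mkContinuous_norm_le zero_le_one hJ, fun i => ?_⟩
  change ∑ j : Fin N, (EuclideanSpace.single i (1 : ℂ)) j • e j = e i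
  rw [Finset.sum_eq_single i] <;> simp +contextual

/-- An operator `A` on a finite dimensional space with `‖A x‖ ≤ ‖T J x‖` for a contraction `J` has
its singular values dominated by those of `T`. -/
theorem norm_apply_eigenvectorBasis_le_singularValue {E : Type*} [NormedAddCommGroup E]
    [InnerProductSpace ℂ E] [FiniteDimensional ℂ E] {N : ℕ} (hN : Module.finrank ℂ E = N)
    (A : E →ₗ[ℂ] E) (J : E →L[ℂ] H) (hJ : ‖J‖ ≤ 1) (T : H →L[ℂ] H)
    (hA : ∀ x, ‖A x‖ ≤ ‖T (J x)‖) (i : Fin N) :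
    ‖A (A.isSymmetric_adjoint_comp_self.eigenvectorBasis hN i)‖ ≤ singularValue T i := by
  set g := A.isSymmetric_adjoint_comp_self.eigenvectorBasis hN with hg
  set l := A.isSymmetric_adjoint_comp_self.eigenvalues hN with hl
  have hin : ∀ a b, inner ℂ (A (g a)) (A (g b)) = (l b : ℂ) * inner ℂ (g a) (g b) := fun a b => by
    rw [← LinearMap.adjoint_inner_right, ← LinearMap.comp_apply, hg,
      LinearMap.IsSymmetric.apply_eigenvectorBasis, inner_smul_right]
    rfl
  have horth : Pairwise fun a b => inner ℂ (g a) (g b) = 0 := fun a b hab => g.orthonormal.2 hab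
  have hAorth : Pairwise fun a b => inner ℂ (A (g a)) (A (g b)) = 0 := fun a b hab => by
    simp only [hin, horth hab, mul_zero]
  have hAn : ∀ a, ‖A (g a)‖ ^ 2 = l a := fun a => by
    have h1 := hin a a
    rw [inner_self_eq_norm_sq_to_K, inner_self_eq_norm_sq_to_K, g.orthonormal.1 a] at h1
    simp only [RCLike.ofReal_one, one_pow, mul_one] at h1
    exact Complex.ofReal_injective (by push_cast; exact h1)
  refine le_of_forall_pos_le_add fun ε hε => ?_
  obtain ⟨F, hF, hlt⟩ := exists_norm_sub_lt T i hε
  refine le_trans ?_ hlt.le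
  -- a dimension count yields a vector in the span of the first `i + 1` eigenvectors killed by `F J`
  let ι : Fin (i + 1) → Fin N := Fin.castLE i.isLt
  let M : (Fin (i + 1) → ℂ) →ₗ[ℂ] E := Fintype.linearCombination ℂ (fun j => g (ι j))
  let L : (Fin (i + 1) → ℂ) →ₗ[ℂ] H := (F : H →ₗ[ℂ] H) ∘ₗ (J : E →ₗ[ℂ] H) ∘ₗ M
  have hnot : ¬ Function.Injective L := by
    intro hinj
    have : FiniteDimensional ℂ (LinearMap.range (F : H →ₗ[ℂ] H)) :=
      Module.rank_lt_aleph0_iff.1 (hF.trans_lt Cardinal.natCast_lt_aleph0)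
    have h1 : Module.finrank ℂ (LinearMap.range L) = i + 1 := by
      rw [LinearMap.finrank_range_of_inj hinj]; simp
    have h2 : Module.finrank ℂ (LinearMap.range L) ≤
        Module.finrank ℂ (LinearMap.range (F : H →ₗ[ℂ] H)) :=
      Submodule.finrank_mono (LinearMap.range_comp_le_range _ _)
    have h3 := Module.finrank_le_of_rank_le hF
    omega
  rw [injective_iff_map_eq_zero] at hnot
  push Not at hnot
  obtain ⟨c, hc, hc0⟩ := hnot
  have hιinj : Function.Injective ι := Fin.castLE_injective _
  have hM : M c = ∑ j, c j • g (ι j) := Fintype.linearCombination_apply ..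
  have hx : ‖M c‖ ^ 2 = ∑ j, ‖c j‖ ^ 2 := by
    rw [hM, norm_sq_sum_smul_of_orthogonal _ fun a b hab => horth (hιinj.ne hab)]
    simp [g.orthonormal.1]
  have hAx : ‖A (M c)‖ ^ 2 = ∑ j, ‖c j‖ ^ 2 * l (ι j) := by
    rw [hM, map_sum]
    simp_rw [map_smul]
    rw [norm_sq_sum_smul_of_orthogonal _ fun a b hab => hAorth (hιinj.ne hab)]
    simp_rw [hAn]
  have hpos : 0 < ‖M c‖ ^ 2 := by
    rw [hx]
    obtain ⟨j, hj⟩ := Function.ne_iff.1 hc0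
    exact Finset.sum_pos' (fun _ _ => by positivity) ⟨j, Finset.mem_univ _, by
      have : 0 < ‖c j‖ := norm_pos_iff.2 hj
      positivity⟩
  have hlow : l i * ‖M c‖ ^ 2 ≤ ‖A (M c)‖ ^ 2 := by
    rw [hAx, hx, Finset.mul_sum]
    refine Finset.sum_le_sum fun j _ => ?_
    rw [mul_comm]
    refine mul_le_mul_of_nonneg_left ?_ (by positivity)
    exact A.isSymmetric_adjoint_comp_self.eigenvalues_antitone hN
      (Fin.le_def.2 (Nat.lt_succ_iff.1 j.isLt))
  have hup : ‖A (M c)‖ ≤ ‖T - F‖ * ‖M c‖ := by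
    have h0 : F (J (M c)) = 0 := hc
    calc ‖A (M c)‖ ≤ ‖T (J (M c))‖ := hA _
      _ = ‖(T - F) (J (M c))‖ := by simp [h0]
      _ ≤ ‖T - F‖ * (‖J‖ * ‖M c‖) := ((T - F).le_opNorm _).trans
          (mul_le_mul_of_nonneg_left (J.le_opNorm _) (norm_nonneg _))
      _ ≤ ‖T - F‖ * (1 * ‖M c‖) := by gcongr
      _ = _ := by ring
  have h5 : l i * ‖M c‖ ^ 2 ≤ ‖T - F‖ ^ 2 * ‖M c‖ ^ 2 := by
    rw [← mul_pow]
    exact hlow.trans (pow_le_pow_left₀ (norm_nonneg _) hup 2)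
  exact le_of_sq_le_sq ((hAn i).le.trans (le_of_mul_le_mul_right h5 hpos)) (norm_nonneg _)

variable [CompleteSpace H]

theorem norm_sum_rankOne_le {e f : ℕ → H} (he : IsSubOrthonormal e) (hf : IsSubOrthonormal f)
    (N : ℕ) : ‖∑ i ∈ Finset.range N, InnerProductSpace.rankOne ℂ (e i) (f i)‖ ≤ 1 := by
  obtain ⟨J, hJ, hJe⟩ := he.exists_synthesis N
  obtain ⟨K, hK, hKf⟩ := hf.exists_synthesis N
  have h1 : ∑ i ∈ Finset.range N, InnerProductSpace.rankOne ℂ (e i) (f i) = J ∘L adjoint K := by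
    ext y
    have h2 : adjoint K y = ∑ i : Fin N, inner ℂ (f i) y • EuclideanSpace.single i (1 : ℂ) := by
      conv_lhs => rw [← (EuclideanSpace.basisFun (Fin N) ℂ).sum_repr' (adjoint K y)]
      refine Finset.sum_congr rfl fun i _ => ?_
      rw [ContinuousLinearMap.adjoint_inner_right, EuclideanSpace.basisFun_apply, hKf]
    rw [ContinuousLinearMap.comp_apply, h2, map_sum, ← Fin.sum_univ_eq_sum_range
      (fun i => InnerProductSpace.rankOne ℂ (e i) (f i))]
    simp [hJe]
  rw [h1]
  refine (ContinuousLinearMap.opNorm_comp_le _ _).trans ?_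
  rw [LinearIsometryEquiv.norm_map]
  exact mul_le_one₀ hJ (norm_nonneg _) hK

/-- The upper half of Ky Fan's principle. The sum is the trace of the compression `K† T J`; in an
eigenbasis `g` of `|K† T J|²` this trace is at most `∑ ‖K† T J g i‖`. -/
theorem norm_sum_inner_le_sum_singularValue (T : H →L[ℂ] H) {e f : ℕ → H}
    (he : IsSubOrthonormal e) (hf : IsSubOrthonormal f) (N : ℕ) :
    ‖∑ i ∈ Finset.range N, inner ℂ (f i) (T (e i))‖ ≤
      ∑ i ∈ Finset.range N, singularValue T i := by
  obtain ⟨J, hJ, hJe⟩ := he.exists_synthesis N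
  obtain ⟨K, hK, hKf⟩ := hf.exists_synthesis N
  let A : EuclideanSpace ℂ (Fin N) →ₗ[ℂ] EuclideanSpace ℂ (Fin N) :=
    (adjoint K ∘L T ∘L J : EuclideanSpace ℂ (Fin N) →L[ℂ] EuclideanSpace ℂ (Fin N))
  have hA : ∀ x, ‖A x‖ ≤ ‖T (J x)‖ := fun x => by
    refine ((adjoint K).le_opNorm _).trans ?_
    rw [LinearIsometryEquiv.norm_map]
    exact mul_le_of_le_one_left (norm_nonneg _) hK
  have hN : Module.finrank ℂ (EuclideanSpace ℂ (Fin N)) = N := by simp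
  let g := A.isSymmetric_adjoint_comp_self.eigenvectorBasis hN
  have h1 : ∑ i ∈ Finset.range N, inner ℂ (f i) (T (e i)) = ∑ i, inner ℂ (g i) (A (g i)) := by
    rw [← LinearMap.trace_eq_sum_inner A g,
      LinearMap.trace_eq_sum_inner A (EuclideanSpace.basisFun (Fin N) ℂ),
      ← Fin.sum_univ_eq_sum_range (fun i => inner ℂ (f i) (T (e i)))]
    refine Finset.sum_congr rfl fun i _ => ?_
    rw [EuclideanSpace.basisFun_apply]
    change _ = inner ℂ _ (adjoint K (T (J _)))
    rw [ContinuousLinearMap.adjoint_inner_right, hKf, hJe]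
  rw [h1, ← Fin.sum_univ_eq_sum_range (singularValue T)]
  refine (norm_sum_le _ _).trans (Finset.sum_le_sum fun i _ => ?_)
  refine (norm_inner_le_norm _ _).trans ?_
  rw [g.orthonormal.1, one_mul]
  exact norm_apply_eigenvectorBasis_le_singularValue hN A J hJ T hA i

/-- A nearly maximizing pair for the norm: unit vectors `e`, `f` with `S e = c f` and
`c ≥ ‖S‖ - δ`. The choice `e = S† y / ‖S† y‖` makes `e` orthogonal to the kernel of `S`. -/
theorem exists_almost_maximizing {S : H →L[ℂ] H} (hS : S ≠ 0) {δ : ℝ} (hδ : 0 < δ) :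
    ∃ (e f : H) (c : ℝ), ‖e‖ = 1 ∧ ‖f‖ = 1 ∧ 0 < c ∧ ‖S‖ - δ ≤ c ∧ S e = (c : ℂ) • f ∧
      ∀ x, S x = 0 → inner ℂ e x = 0 := by
  have hS0 : 0 < ‖S‖ := norm_pos_iff.2 hS
  have hr : max 0 (‖S‖ - δ) < ‖adjoint S‖ := by
    rw [LinearIsometryEquiv.norm_map]
    exact max_lt hS0 (by linarith)
  obtain ⟨y, hy1, hy⟩ := (adjoint S).exists_lt_apply_of_lt_opNorm hr
  set a := ‖adjoint S y‖ with ha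
  have ha0 : 0 < a := (le_max_left _ _).trans_lt hy
  have hac : (a : ℂ) ≠ 0 := by exact_mod_cast ha0.ne'
  set e : H := (a⁻¹ : ℂ) • adjoint S y with he
  have he1 : ‖e‖ = 1 := by
    rw [he, norm_smul, norm_inv, Complex.norm_real, Real.norm_of_nonneg ha0.le, ← ha,
      inv_mul_cancel₀ ha0.ne']
  have hac' : a ≤ ‖S e‖ := by
    have h1 : inner ℂ y (S e) = (a : ℂ) := by
      rw [← ContinuousLinearMap.adjoint_inner_left, he, inner_smul_right,
        inner_self_eq_norm_sq_to_K]
      change (a : ℂ)⁻¹ * ((a : ℝ) : ℂ) ^ 2 = a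
      field_simp
    have h2 : a = ‖inner ℂ y (S e)‖ := by
      rw [h1, Complex.norm_real, Real.norm_of_nonneg ha0.le]
    rw [h2]
    refine (norm_inner_le_norm _ _).trans ?_
    exact mul_le_of_le_one_left (norm_nonneg _) hy1.le
  have hc : 0 < ‖S e‖ := ha0.trans_le hac'
  have hcc : ((‖S e‖ : ℝ) : ℂ) ≠ 0 := by exact_mod_cast hc.ne'
  refine ⟨e, ((‖S e‖ : ℝ) : ℂ)⁻¹ • S e, ‖S e‖, he1, ?_, hc,
    ((le_max_right _ _).trans hy.le).trans hac', ?_, fun x hx => ?_⟩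
  · rw [norm_smul, norm_inv, Complex.norm_real, Real.norm_of_nonneg hc.le, inv_mul_cancel₀ hc.ne']
  · rw [smul_smul, mul_inv_cancel₀ hcc, one_smul]
  · rw [he, inner_smul_left, ContinuousLinearMap.adjoint_inner_left, hx, inner_zero_right, mul_zero]

/-- If `S e = c f` with `c` close to `‖S‖`, then `S` nearly maps `e⊥` into `f⊥`. -/
theorem norm_inner_le_of_almost_maximizing {S : H →L[ℂ] H} {e f : H} {c δ : ℝ} (he : ‖e‖ = 1)
    (hf : ‖f‖ = 1) (hc0 : 0 < c) (hδ : 0 < δ) (hc : ‖S‖ - δ ≤ c) (hSe : S e = (c : ℂ) • f) {y : H}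
    (hy : inner ℂ e y = 0) : ‖inner ℂ f (S y)‖ ≤ √(2 * δ * ‖S‖) * ‖y‖ := by
  have hff : inner ℂ f f = (1 : ℂ) := by rw [inner_self_eq_norm_sq_to_K, hf]; simp
  have h1 : inner ℂ f (S y) = inner ℂ (adjoint S f - (c : ℂ) • e) y := by
    rw [inner_sub_left, ContinuousLinearMap.adjoint_inner_left, inner_smul_left, hy, mul_zero,
      sub_zero]
  have h2 : ‖adjoint S f - (c : ℂ) • e‖ ^ 2 = ‖adjoint S f‖ ^ 2 - c ^ 2 := by
    rw [norm_sub_sq (𝕜 := ℂ), inner_smul_right, ContinuousLinearMap.adjoint_inner_left, hSe,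
      inner_smul_right, hff, norm_smul, he, Complex.norm_real, Real.norm_of_nonneg hc0.le]
    simp
    ring
  have h3 : ‖adjoint S f‖ ≤ ‖S‖ := by
    refine ((adjoint S).le_opNorm f).trans ?_
    rw [hf, mul_one, LinearIsometryEquiv.norm_map]
  have h4 : ‖S‖ ^ 2 - c ^ 2 ≤ 2 * δ * ‖S‖ := by
    rcases le_total δ ‖S‖ with h | h
    · nlinarith [norm_nonneg S]
    · nlinarith [norm_nonneg S]
  rw [h1]
  refine (norm_inner_le_norm _ _).trans (mul_le_mul_of_nonneg_right ?_ (norm_nonneg _))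
  refine Real.le_sqrt_of_sq_le ?_
  rw [h2]
  have h5 : ‖adjoint S f‖ ^ 2 ≤ ‖S‖ ^ 2 := pow_le_pow_left₀ (norm_nonneg _) h3 2
  linarith

/-- The lower half of Ky Fan's principle, for an arbitrary bounded operator. The vectors are chosen
greedily: after a nearly maximizing pair `e`, `f` the construction continues with
`S' = (1 - |f⟩⟨f|) S (1 - |e⟩⟨e|)`, and `s_{i + 1}(S) ≤ s_i(S') + η` since `S'` is within `η` of the
rank one perturbation `S (1 - |e⟩⟨e|)` of `S`. Orthogonality to the kernels makes the vectors found
for `S'` orthogonal to `e` and `f`. -/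
theorem exists_sum_singularValue_le (N : ℕ) (S : H →L[ℂ] H) {ε : ℝ} (hε : 0 < ε) :
    ∃ e f : ℕ → H, IsSubOrthonormal e ∧ IsSubOrthonormal f ∧
      (∀ i x, S x = 0 → inner ℂ (e i) x = 0) ∧
      (∀ i y, adjoint S y = 0 → inner ℂ (f i) y = 0) ∧
      ∑ i ∈ Finset.range N, singularValue S i ≤
        (∑ i ∈ Finset.range N, inner ℂ (f i) (S (e i))).re + ε := by
  induction N generalizing S ε with
  | zero => exact ⟨0, 0, ⟨by simp, fun _ _ _ => by simp⟩, ⟨by simp, fun _ _ _ => by simp⟩, by simp,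
      by simp, by simpa using hε.le⟩
  | succ N ih =>
    by_cases hS : S = 0
    · refine ⟨0, 0, ⟨by simp, fun _ _ _ => by simp⟩, ⟨by simp, fun _ _ _ => by simp⟩, by simp,
        by simp, ?_⟩
      simp [hS, singularValue_zero, hε.le]
    have hS0 : 0 < ‖S‖ := norm_pos_iff.2 hS
    -- `ε` is split into `δ` for the norm, `N * η` for the shift of the singular values, and `ε / 3`
    -- for the induction hypothesis
    set η : ℝ := ε / (3 * (N + 1)) with hη_def
    have hη : 0 < η := by positivity
    set δ : ℝ := min (ε / 3) (η ^ 2 / (2 * ‖S‖)) with hδ_def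
    have hδ : 0 < δ := by positivity
    have hδη : √(2 * δ * ‖S‖) ≤ η := by
      rw [Real.sqrt_le_left hη.le]
      calc 2 * δ * ‖S‖ ≤ 2 * (η ^ 2 / (2 * ‖S‖)) * ‖S‖ := by gcongr; exact min_le_right _ _
        _ = η ^ 2 := by field_simp
    obtain ⟨e₀, f₀, c, he₀, hf₀, hc0, hc, hSe, hker⟩ := exists_almost_maximizing hS hδ
    have hee : inner ℂ e₀ e₀ = (1 : ℂ) := by rw [inner_self_eq_norm_sq_to_K, he₀]; simp
    have hff : inner ℂ f₀ f₀ = (1 : ℂ) := by rw [inner_self_eq_norm_sq_to_K, hf₀]; simp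
    let p : H →L[ℂ] H := InnerProductSpace.rankOne ℂ e₀ e₀
    let q : H →L[ℂ] H := InnerProductSpace.rankOne ℂ f₀ f₀
    have hp : ∀ x, p x = inner ℂ e₀ x • e₀ := fun x => rfl
    have hq : ∀ x, q x = inner ℂ f₀ x • f₀ := fun x => rfl
    let S₁ : H →L[ℂ] H := S ∘L (1 - p)
    let S' : H →L[ℂ] H := (1 - q) ∘L S₁
    have hperp : ∀ x, inner ℂ e₀ (x - p x) = 0 := fun x => by
      rw [hp, inner_sub_right, inner_smul_right, hee, mul_one, sub_self]
    have hS₁S' : ‖S₁ - S'‖ ≤ η := by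
      refine ContinuousLinearMap.opNorm_le_bound _ hη.le fun x => ?_
      have h1 : (S₁ - S') x = inner ℂ f₀ (S (x - p x)) • f₀ := by
        change S (x - p x) - (S (x - p x) - q (S (x - p x))) = _
        rw [hq, sub_sub_cancel]
      rw [h1, norm_smul, hf₀, mul_one]
      have h2 : ‖x - p x‖ ≤ ‖x‖ := by
        have h3 : ‖x - p x‖ ^ 2 + ‖p x‖ ^ 2 = ‖x‖ ^ 2 := by
          have := norm_add_sq_eq_norm_sq_add_norm_sq_of_inner_eq_zero (𝕜 := ℂ) (p x) (x - p x)
            (by rw [hp, inner_smul_left, ← hp, hperp, mul_zero])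
          rw [add_sub_cancel] at this
          nlinarith
        exact le_of_sq_le_sq (by nlinarith [sq_nonneg ‖p x‖]) (norm_nonneg _)
      calc ‖inner ℂ f₀ (S (x - p x))‖ ≤ √(2 * δ * ‖S‖) * ‖x - p x‖ :=
            norm_inner_le_of_almost_maximizing he₀ hf₀ hc0 hδ hc hSe (hperp x)
        _ ≤ η * ‖x‖ := by gcongr
    have hshift : ∀ i, singularValue S (i + 1) ≤ singularValue S' i + η := by
      intro i
      have hrank : LinearMap.rank ((S ∘L p : H →L[ℂ] H) : H →ₗ[ℂ] H) ≤ ((1 : ℕ) : Cardinal) := by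
        have h1 : LinearMap.range ((S ∘L p : H →L[ℂ] H) : H →ₗ[ℂ] H) ≤
            Submodule.span ℂ {S e₀} := by
          rintro _ ⟨x, rfl⟩
          change S (p x) ∈ _
          rw [hp, map_smul]
          exact Submodule.smul_mem _ _ (Submodule.mem_span_singleton_self _)
        exact (Submodule.rank_mono h1).trans ((rank_span_le _).trans (by simp))
      have h2 : S = S₁ + S ∘L p := by ext x; simp [S₁]
      have h3 := singularValue_add_le S₁ (S ∘L p) i 1
      rw [← h2, singularValue_eq_zero_of_rank_le hrank le_rfl, add_zero] at h3
      have h4 := singularValue_add_le S' (S₁ - S') i 0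
      rw [add_sub_cancel, add_zero, singularValue_index_zero] at h4
      linarith
    obtain ⟨e', f', he', hf', hke, hkf, hsum⟩ := ih S' (ε := ε / 3) (by positivity)
    have hkerS' : ∀ x, S x = 0 → S' x = 0 := fun x hx => by
      simp [S', S₁, hp, hker x hx, hx]
    have hpq : ∀ x y, inner ℂ y (S' x) = inner ℂ (y - q y) (S (x - p x)) := fun x y => by
      change inner ℂ y (S (x - p x) - q (S (x - p x))) = _
      rw [hq, hq, inner_sub_right, inner_sub_left, inner_smul_right, inner_smul_left,
        inner_conj_symm, mul_comm]
    have hadj : ∀ y, (∀ x, inner ℂ (y - q y) (S x) = 0) → adjoint S' y = 0 := fun y hy => by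
      refine ext_inner_right ℂ fun x => ?_
      rw [ContinuousLinearMap.adjoint_inner_left, hpq, hy, inner_zero_left]
    have hfker : ∀ y, adjoint S y = 0 → inner ℂ f₀ y = 0 := fun y hy => by
      have h1 : inner ℂ (S e₀) y = 0 := by
        rw [← ContinuousLinearMap.adjoint_inner_right, hy, inner_zero_right]
      rw [hSe, inner_smul_left] at h1
      have h2 : (starRingEnd ℂ) (c : ℂ) ≠ 0 := by
        rw [Complex.conj_ofReal]; exact_mod_cast hc0.ne'
      exact (mul_eq_zero.1 h1).resolve_left h2
    have he'0 : ∀ i, inner ℂ (e' i) e₀ = 0 := fun i => hke i e₀ (by simp [S', S₁, hp, he₀])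
    have hf'0 : ∀ i, inner ℂ (f' i) f₀ = 0 := fun i => hkf i f₀ (hadj f₀ fun x => by
      simp [hq, hf₀])
    have hcons : ∀ {z : ℕ → H} {z₀ : H}, IsSubOrthonormal z → ‖z₀‖ = 1 →
        (∀ i, inner ℂ (z i) z₀ = 0) →
        IsSubOrthonormal (fun n => Nat.casesOn n z₀ z : ℕ → H) := by
      intro z z₀ hz hz₀ hzz
      refine ⟨?_, ?_⟩
      · rintro (_ | i)
        exacts [hz₀.le, hz.1 i]
      · rintro (_ | i) (_ | j) hij
        · exact absurd rfl hij
        · exact inner_eq_zero_symm.1 (hzz j)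
        · exact hzz i
        · exact hz.2 fun h => hij (by rw [h])
    refine ⟨fun n => Nat.casesOn n e₀ e', fun n => Nat.casesOn n f₀ f', hcons he' he₀ he'0,
      hcons hf' hf₀ hf'0, ?_, ?_, ?_⟩
    · rintro (_ | i) x hx
      · exact hker x hx
      · exact hke i x (hkerS' x hx)
    · rintro (_ | i) y hy
      · exact hfker y hy
      · refine hkf i y (hadj y fun x => ?_)
        rw [hq, hfker y hy, zero_smul, sub_zero, ← ContinuousLinearMap.adjoint_inner_left, hy,
          inner_zero_left]
    · rw [Finset.sum_range_succ', Finset.sum_range_succ' (fun i => inner ℂ _ _)]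
      have h1 : ∀ i, inner ℂ (f' i) (S (e' i)) = inner ℂ (f' i) (S' (e' i)) := fun i => by
        rw [hpq, hp, hq, inner_eq_zero_symm.1 (he'0 i), inner_eq_zero_symm.1 (hf'0 i)]
        simp
      have h2 : inner ℂ f₀ (S e₀) = (c : ℂ) := by rw [hSe, inner_smul_right, hff, mul_one]
      change _ ≤ (∑ i ∈ Finset.range N, inner ℂ (f' i) (S (e' i)) + inner ℂ f₀ (S e₀)).re + ε
      simp_rw [h1, h2]
      rw [Complex.add_re, Complex.ofReal_re, singularValue_index_zero]
      have h3 : ∑ i ∈ Finset.range N, singularValue S (i + 1) ≤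
          ∑ i ∈ Finset.range N, singularValue S' i + N * η := by
        refine (Finset.sum_le_sum fun i _ => hshift i).trans ?_
        rw [Finset.sum_add_distrib]
        simp
      have h4 : N * η ≤ ε / 3 := by
        rw [hη_def, mul_div_assoc', div_le_div_iff₀ (by positivity) (by norm_num)]
        nlinarith
      have h5 : δ ≤ ε / 3 := min_le_left _ _
      linarith

end KyFan

/-! ### Weak majorization -/

/-- Abel summation: sums with antitone nonnegative weights inherit nonnegativity of partial sums. -/
theorem sum_mul_nonneg_of_antitone {w d : ℕ → ℝ} (hw : Antitone w) (hw0 : ∀ n, 0 ≤ w n)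
    (hd : ∀ N, 0 ≤ ∑ n ∈ Finset.range N, d n) (N : ℕ) :
    0 ≤ ∑ n ∈ Finset.range N, w n * d n := by
  have h : ∀ N, w N * ∑ n ∈ Finset.range N, d n ≤ ∑ n ∈ Finset.range N, w n * d n := by
    intro N
    induction N with
    | zero => simp
    | succ N ih =>
      have h1 := mul_le_mul_of_nonneg_right (hw (Nat.le_succ N)) (hd (N + 1))
      rw [Finset.sum_range_succ (fun n => w n * d n)]
      have h2 : w N * ∑ n ∈ Finset.range (N + 1), d n =
          w N * ∑ n ∈ Finset.range N, d n + w N * d N := by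
        rw [Finset.sum_range_succ, mul_add]
      linarith
  exact (mul_nonneg (hw0 N) (hd N)).trans (h N)

/-- The tangent line inequality for the convex function `x ↦ x ^ p`. -/
theorem rpow_add_mul_sub_le_rpow {p s t : ℝ} (hp : 1 ≤ p) (hs : 0 ≤ s) (ht : 0 ≤ t) :
    s ^ p + p * s ^ (p - 1) * (t - s) ≤ t ^ p := by
  rcases hs.eq_or_lt with rfl | hs
  · rcases hp.eq_or_lt with rfl | hp
    · simp
    · rw [Real.zero_rpow (by linarith), Real.zero_rpow (by linarith)]
      simpa using Real.rpow_nonneg ht p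
  · have h1 := one_add_mul_self_le_rpow_one_add (s := t / s - 1) (by
      have : 0 ≤ t / s := by positivity
      linarith) hp
    rw [add_sub_cancel, Real.div_rpow ht hs.le, le_div_iff₀ (by positivity)] at h1
    have h2 : s ^ p = s ^ (p - 1) * s := by
      rw [← Real.rpow_add_one hs.ne', sub_add_cancel]
    calc s ^ p + p * s ^ (p - 1) * (t - s) = (1 + p * (t / s - 1)) * s ^ p := by
          rw [h2]; field_simp
      _ ≤ t ^ p := h1

/-- Weak majorization of antitone sequences is inherited by `p`-th powers. -/
theorem sum_rpow_le_sum_rpow_of_majorized {p : ℝ} (hp : 1 ≤ p) {s t : ℕ → ℝ} (hs : Antitone s)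
    (hs0 : ∀ n, 0 ≤ s n) (ht0 : ∀ n, 0 ≤ t n)
    (h : ∀ N, ∑ n ∈ Finset.range N, s n ≤ ∑ n ∈ Finset.range N, t n) (N : ℕ) :
    ∑ n ∈ Finset.range N, s n ^ p ≤ ∑ n ∈ Finset.range N, t n ^ p := by
  have h1 := sum_mul_nonneg_of_antitone (w := fun n => p * s n ^ (p - 1)) (d := fun n => t n - s n)
    (fun m n hmn => mul_le_mul_of_nonneg_left
      (Real.rpow_le_rpow (hs0 n) (hs hmn) (by linarith)) (by linarith))
    (fun n => mul_nonneg (by linarith) (Real.rpow_nonneg (hs0 n) _))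
    (fun N => by rw [Finset.sum_sub_distrib]; linarith [h N]) N
  have h2 := Finset.sum_le_sum fun n (_ : n ∈ Finset.range N) =>
    rpow_add_mul_sub_le_rpow hp (hs0 n) (ht0 n)
  rw [Finset.sum_add_distrib] at h2
  linarith

/-! ### Averages of two-sided multiplications -/

section Average

variable {H : Type*} [NormedAddCommGroup H] [InnerProductSpace ℂ H]

/-- On a separable space the identity is the strong limit of finite rank contractions. -/
theorem exists_finiteRank_tendsto_id [SeparableSpace H] :
    ∃ π : ℕ → H →L[ℂ] H, (∀ N, ‖π N‖ ≤ 1) ∧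
      (∀ N, ∃ r : ℕ, LinearMap.rank (π N : H →ₗ[ℂ] H) ≤ (r : Cardinal)) ∧
      ∀ x, Filter.Tendsto (fun N => π N x) Filter.atTop (nhds x) := by
  let U : ℕ → Submodule ℂ H := fun N =>
    Submodule.span ℂ (denseSeq H '' Set.Iio N)
  have hmono : Monotone U := fun M N hMN =>
    Submodule.span_mono (Set.image_mono (Set.Iio_subset_Iio hMN))
  have hfin : ∀ N, FiniteDimensional ℂ (U N) := fun N =>
    FiniteDimensional.span_of_finite ℂ ((Set.finite_Iio N).image _)
  have htop : ⊤ ≤ (⨆ N, U N).topologicalClosure := by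
    intro x _
    refine closure_mono ?_ (denseRange_denseSeq H x)
    rintro _ ⟨n, rfl⟩
    refine Submodule.mem_iSup_of_mem (n + 1) (Submodule.subset_span ?_)
    exact Set.mem_image_of_mem _ (Set.mem_Iio.2 n.lt_succ_self)
  refine ⟨fun N => (U N).starProjection, fun N => Submodule.starProjection_norm_le _, fun N => ?_,
    fun x => Submodule.starProjection_tendsto_self U hmono x htop⟩
  refine ⟨Module.finrank ℂ (U N), ?_⟩
  rw [Module.finrank_eq_rank]
  refine Submodule.rank_mono ?_
  rintro _ ⟨x, rfl⟩
  exact Submodule.starProjection_apply_mem _ x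

/-- A strongly measurable family of contractions on a Hilbert space, parametrized by the line. -/
structure IsContractionFamily (U : ℝ → H →L[ℂ] H) : Prop where
  stronglyMeasurable : ∀ h, StronglyMeasurable fun t => U t h
  norm_le_one : ∀ t, ‖U t‖ ≤ 1

variable {U V : ℝ → H →L[ℂ] H} {f : ℝ → ℂ}

theorem IsContractionFamily.norm_apply_le (hU : IsContractionFamily U) (hV : IsContractionFamily V)
    (T : H →L[ℂ] H) (h : H) (t : ℝ) : ‖U t (T (V t h))‖ ≤ ‖T‖ * ‖h‖ := by
  calc ‖U t (T (V t h))‖ ≤ 1 * ‖T (V t h)‖ := (U t).le_of_opNorm_le (hU.norm_le_one t) _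
    _ ≤ ‖T‖ * ‖V t h‖ := by rw [one_mul]; exact T.le_opNorm _
    _ ≤ ‖T‖ * ‖h‖ := by
      gcongr
      simpa using (V t).le_of_opNorm_le (hV.norm_le_one t) h

variable [CompleteSpace H]

/-- Pettis' theorem for Hilbert spaces: in a separable space weak measurability is strong
measurability. -/
theorem stronglyMeasurable_of_inner [SeparableSpace H] {X : Type*} [MeasurableSpace X] {w : X → H}
    (hw : ∀ k, Measurable fun x => inner ℂ k (w x)) : StronglyMeasurable w := by
  obtain ⟨π, -, hr, hπ⟩ := exists_finiteRank_tendsto_id (H := H)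
  refine stronglyMeasurable_of_tendsto Filter.atTop (f := fun N x => π N (w x)) (fun N => ?_)
    (tendsto_pi_nhds.2 fun x => hπ (w x))
  obtain ⟨r, hr⟩ := hr N
  obtain ⟨u, v, -, -, -, -, huv⟩ := exists_eq_sum_rankOne hr
  simp_rw [huv]
  exact Finset.stronglyMeasurable_fun_sum _ fun i _ =>
    (hw (u i)).stronglyMeasurable.smul_const (v i)

theorem MeasureTheory.StronglyMeasurable.clm_family_apply [SeparableSpace H] {X : Type*}
    [MeasurableSpace X] {A : X → H →L[ℂ] H} (hA : ∀ h, StronglyMeasurable fun x => A x h)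
    {w : X → H} (hw : StronglyMeasurable w) : StronglyMeasurable fun x => A x (w x) := by
  obtain ⟨π, -, hr, hπ⟩ := exists_finiteRank_tendsto_id (H := H)
  refine stronglyMeasurable_of_tendsto Filter.atTop (f := fun N x => A x (π N (w x))) (fun N => ?_)
    (tendsto_pi_nhds.2 fun x => ((A x).continuous.tendsto _).comp (hπ (w x)))
  obtain ⟨r, hr⟩ := hr N
  obtain ⟨u, v, -, -, -, -, huv⟩ := exists_eq_sum_rankOne hr
  simp_rw [huv, map_sum, map_smul]
  exact Finset.stronglyMeasurable_fun_sum _ fun i _ =>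
    (stronglyMeasurable_const.inner hw).smul (hA (v i))

/-- The integrals of a bounded family of functions depending continuously on a real parameter form
a strongly measurable family of operators. -/
theorem SpectralMeasure.stronglyMeasurable_integral [SeparableSpace H] {α : Type*}
    [MeasurableSpace α] (P : SpectralMeasure α H) {e : ℝ → α → ℂ} (he : ∀ t, Measurable (e t))
    {C : ℝ} (hC : ∀ t x, ‖e t x‖ ≤ C) (hc : ∀ x, Continuous fun t => e t x) (h : H) :
    StronglyMeasurable fun t => P.integral (e t) h := by
  refine stronglyMeasurable_of_inner fun k => Continuous.measurable ?_
  simp_rw [fun t => P.inner_integral (he t) (hC t)]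
  refine continuous_iff_seqContinuous.2 fun s t hst => ?_
  exact ComplexMeasure.tendsto_cintegral _ (fun n => he (s n)) (fun n => hC (s n))
    fun x => ((hc x).tendsto t).comp hst

theorem IsContractionFamily.integrable [SeparableSpace H] (hU : IsContractionFamily U)
    (hV : IsContractionFamily V) (hf : Integrable f) (T : H →L[ℂ] H) (h : H) :
    Integrable fun t => f t • U t (T (V t h)) := by
  refine (hf.norm.mul_const (‖T‖ * ‖h‖)).mono' (hf.1.smul ?_)
    (Filter.Eventually.of_forall fun t => ?_)
  · exact (StronglyMeasurable.clm_family_apply hU.stronglyMeasurable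
      (T.continuous.comp_stronglyMeasurable (hV.stronglyMeasurable h))).aestronglyMeasurable
  · rw [norm_smul]
    gcongr
    exact hU.norm_apply_le hV T h t

/-- The operator `T ↦ ∫ f(t) U(t) T V(t) dt` on `L(H)`, the integral being taken strongly. -/
theorem IsContractionFamily.exists_average [SeparableSpace H] (hU : IsContractionFamily U)
    (hV : IsContractionFamily V) (hf : Integrable f) :
    ∃ Φ : (H →L[ℂ] H) →L[ℂ] (H →L[ℂ] H),
      (∀ T h, Φ T h = ∫ t, f t • U t (T (V t h))) ∧ ‖Φ‖ ≤ ∫ t, ‖f t‖ := by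
  have hi := hU.integrable hV hf
  let B : (H →L[ℂ] H) →ₗ[ℂ] H →ₗ[ℂ] H := LinearMap.mk₂ ℂ
    (fun T h => ∫ t, f t • U t (T (V t h)))
    (fun S T h => by
      rw [← integral_add (hi S h) (hi T h)]
      simp only [_root_.add_apply, map_add, smul_add])
    (fun c T h => by
      rw [← integral_smul]
      simp only [_root_.smul_apply, map_smul, smul_comm c])
    (fun T g h => by
      rw [← integral_add (hi T g) (hi T h)]
      simp only [map_add, smul_add])
    (fun c T h => by
      rw [← integral_smul]
      simp only [map_smul, smul_comm c])
  have hB : ∀ T h, ‖B T h‖ ≤ (∫ t, ‖f t‖) * ‖T‖ * ‖h‖ := fun T h => by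
    rw [mul_assoc, ← integral_mul_const]
    refine norm_integral_le_of_norm_le (hf.norm.mul_const _)
      (Filter.Eventually.of_forall fun t => ?_)
    rw [norm_smul]
    gcongr
    exact hU.norm_apply_le hV T h t
  exact ⟨B.mkContinuous₂ _ hB, fun T h => rfl,
    B.mkContinuous₂_norm_le (integral_nonneg fun t => norm_nonneg _) hB⟩

end Average

/-! ### The Fourier transform as a superposition of characters -/

theorem norm_exp_neg_I_mul (s t : ℝ) : ‖Complex.exp (-(Complex.I * s * t))‖ = 1 := by
  simp [Complex.norm_exp]

theorem norm_exp_I_mul (s t : ℝ) : ‖Complex.exp (Complex.I * s * t)‖ = 1 := by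
  simp [Complex.norm_exp]

theorem norm_fourierHat_le (f : ℝ → ℂ) (ξ : ℝ) : ‖fourierHat f ξ‖ ≤ ∫ t, ‖f t‖ := by
  refine (norm_integral_le_integral_norm _).trans (le_of_eq ?_)
  simp_rw [norm_mul, norm_exp_neg_I_mul, one_mul]

theorem continuous_fourierHat {f : ℝ → ℂ} (hf : Integrable f) : Continuous (fourierHat f) := by
  refine continuous_of_dominated (bound := fun t => ‖f t‖) (fun ξ => ?_) (fun ξ => ?_) hf.norm ?_
  · exact (by fun_prop : Continuous fun x : ℝ =>
      Complex.exp (-(Complex.I * ξ * x))).aestronglyMeasurable.mul hf.1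
  · refine Filter.Eventually.of_forall fun t => ?_
    rw [norm_mul, norm_exp_neg_I_mul, one_mul]
  · exact Filter.Eventually.of_forall fun t => by fun_prop

section Fourier

variable {H : Type*} [NormedAddCommGroup H] [InnerProductSpace ℂ H] [CompleteSpace H]
  [SeparableSpace H] (P : SpectralMeasure ℝ H)

theorem SpectralMeasure.isContractionFamily_exp_neg :
    IsContractionFamily fun t => P.integral fun s => Complex.exp (-(Complex.I * s * t)) where
  stronglyMeasurable := P.stronglyMeasurable_integral (fun t => by fun_prop)
    (fun t s => (norm_exp_neg_I_mul s t).le) fun s => by fun_prop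
  norm_le_one t := P.norm_integral_le (by fun_prop) zero_le_one
    fun s => (norm_exp_neg_I_mul s t).le

theorem SpectralMeasure.isContractionFamily_exp :
    IsContractionFamily fun t => P.integral fun s => Complex.exp (Complex.I * s * t) where
  stronglyMeasurable := P.stronglyMeasurable_integral (fun t => by fun_prop)
    (fun t s => (norm_exp_I_mul s t).le) fun s => by fun_prop
  norm_le_one t := P.norm_integral_le (by fun_prop) zero_le_one
    fun s => (norm_exp_I_mul s t).le

/-- Fubini's theorem turns `∫ ∫ e^{-it(λ - μ)} f(t) dt d⟪k, P T Q h⟫` into the average of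
`⟪k, U(t) T V(t) h⟫` with the unitary groups `U(t) = ∫ e^{-itλ} dP` and `V(t) = ∫ e^{itμ} dQ`. -/
theorem hasOperatorIntegral_fourierHat (Q : SpectralMeasure ℝ H) {f : ℝ → ℂ} (hf : Integrable f)
    {T S : H →L[ℂ] H} (hT : MemSchatten 1 T)
    (hS : ∀ h, S h = ∫ t, f t • P.integral (fun s => Complex.exp (-(Complex.I * s * t)))
      (T (Q.integral (fun s => Complex.exp (Complex.I * s * t)) h))) :
    HasOperatorIntegral P Q (fun x => fourierHat f (x.1 - x.2)) T S := by
  intro h k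
  obtain ⟨m, hm⟩ := hT.exists_complexMeasure P Q h k
  have hmeas : Measurable fun x : ℝ × ℝ => fourierHat f (x.1 - x.2) :=
    (continuous_fourierHat hf).measurable.comp (measurable_fst.sub measurable_snd)
  have hbound : ∀ x : ℝ × ℝ, ‖fourierHat f (x.1 - x.2)‖ ≤ ∫ t, ‖f t‖ := fun x =>
    norm_fourierHat_le f _
  refine ⟨m, hm, m.integrable_of_bounded hmeas hbound, ?_⟩
  have h1 := m.cintegral_integral hf (e := fun t x =>
    Complex.exp (-(Complex.I * x.1 * t)) * Complex.exp (Complex.I * x.2 * t))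
    (Continuous.measurable (by fun_prop))
    (fun t x => by rw [norm_mul, norm_exp_neg_I_mul, norm_exp_I_mul, one_mul]) hmeas hbound
    fun x => by
      refine integral_congr_ae (Filter.Eventually.of_forall fun t => ?_)
      simp only [← Complex.exp_add]
      push_cast
      ring_nf
  refine Eq.trans ?_ h1.symm
  rw [hS, ← integral_inner (P.isContractionFamily_exp_neg.integrable Q.isContractionFamily_exp hf
    T h)]
  congr 1 with t
  rw [inner_smul_right, cintegral_prod_eq_inner hm (g₁ := fun s : ℝ =>
    Complex.exp (-(Complex.I * s * t))) (g₂ := fun s : ℝ => Complex.exp (Complex.I * s * t))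
    (by fun_prop) (by fun_prop) (fun s => (norm_exp_neg_I_mul s t).le)
    fun s => (norm_exp_I_mul s t).le]

end Fourier

/-! ### The average on the Schatten classes -/

section SchattenAverage

variable {H : Type*} [NormedAddCommGroup H] [InnerProductSpace ℂ H]

theorem MemSchatten.of_sum_singularValue_le {p : ℝ} (hp : 1 ≤ p) {S T : H →L[ℂ] H} {C : ℝ}
    (hC : 0 ≤ C) (hT : MemSchatten p T)
    (h : ∀ N, ∑ n ∈ Finset.range N, singularValue S n ≤
      C * ∑ n ∈ Finset.range N, singularValue T n) :
    MemSchatten p S ∧ schattenNorm p S ≤ C * schattenNorm p T := by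
  have hp0 : 0 < p := by linarith
  have h0 := fun (A : H →L[ℂ] H) n => Real.rpow_nonneg (singularValue_nonneg A n) p
  have h1 : ∀ N, ∑ n ∈ Finset.range N, singularValue S n ^ p ≤
      C ^ p * ∑' n, singularValue T n ^ p := fun N => by
    have h2 := sum_rpow_le_sum_rpow_of_majorized hp (t := fun n => C * singularValue T n)
      (singularValue_antitone S) (singularValue_nonneg S)
      (fun n => mul_nonneg hC (singularValue_nonneg T n))
      (fun N => by rw [← Finset.mul_sum]; exact h N) N
    simp_rw [Real.mul_rpow hC (singularValue_nonneg T _), ← Finset.mul_sum] at h2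
    refine h2.trans ?_
    gcongr
    exact Summable.sum_le_tsum _ (fun n _ => h0 T n) hT
  have hS : MemSchatten p S := summable_of_sum_range_le (h0 S) h1
  refine ⟨hS, ?_⟩
  have h2 : ∑' n, singularValue S n ^ p ≤ C ^ p * ∑' n, singularValue T n ^ p :=
    Real.tsum_le_of_sum_range_le (h0 S) h1
  calc schattenNorm p S ≤ (C ^ p * ∑' n, singularValue T n ^ p) ^ (1 / p) :=
        Real.rpow_le_rpow (tsum_nonneg (h0 S)) h2 (by positivity)
    _ = C * schattenNorm p T := by
        rw [Real.mul_rpow (Real.rpow_nonneg hC p) (tsum_nonneg (h0 T)), ← Real.rpow_mul hC,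
          mul_one_div_cancel hp0.ne', Real.rpow_one]
        rfl

variable [CompleteSpace H]

/-- The singular values of an average of the operators `U(t) T V(t)` are weakly majorized by those
of `T`, because Ky Fan's principle expresses sums of singular values by linear functionals. -/
theorem IsContractionFamily.sum_singularValue_average_le [SeparableSpace H]
    {U V : ℝ → H →L[ℂ] H} {f : ℝ → ℂ} (hU : IsContractionFamily U)
    (hV : IsContractionFamily V) (hf : Integrable f) {T S : H →L[ℂ] H}
    (hS : ∀ h, S h = ∫ t, f t • U t (T (V t h))) (N : ℕ) :
    ∑ n ∈ Finset.range N, singularValue S n ≤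
      (∫ t, ‖f t‖) * ∑ n ∈ Finset.range N, singularValue T n := by
  refine le_of_forall_pos_le_add fun ε hε => ?_
  obtain ⟨e, g, he, hg, -, -, hsum⟩ := exists_sum_singularValue_le N S hε
  refine hsum.trans (add_le_add_left ((Complex.re_le_norm _).trans ?_) ε)
  have h1 : ∑ n ∈ Finset.range N, inner ℂ (g n) (S (e n)) =
      ∫ t, f t * ∑ n ∈ Finset.range N, inner ℂ (g n) (U t (T (V t (e n)))) := by
    have h2 : ∀ n, Integrable fun t => inner ℂ (g n) (f t • U t (T (V t (e n)))) := fun n =>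
      (hU.integrable hV hf T (e n)).const_inner (g n)
    have h3 : ∀ n, inner ℂ (g n) (S (e n)) = ∫ t, inner ℂ (g n) (f t • U t (T (V t (e n)))) :=
      fun n => by rw [hS, integral_inner (hU.integrable hV hf T (e n))]
    simp_rw [h3]
    rw [← integral_finsetSum _ fun n _ => h2 n]
    simp_rw [inner_smul_right, Finset.mul_sum]
  rw [h1, ← integral_mul_const]
  refine norm_integral_le_of_norm_le (hf.norm.mul_const _) (Filter.Eventually.of_forall fun t => ?_)
  rw [norm_mul]
  gcongr
  refine (norm_sum_inner_le_sum_singularValue (U t ∘L T ∘L V t) he hg N).trans ?_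
  exact Finset.sum_le_sum fun n _ =>
    singularValue_comp_comp_le (hU.norm_le_one t) (hV.norm_le_one t) T n

variable {α β : Type*} [MeasurableSpace α] [MeasurableSpace β]

/-- Finite rank operators are dense in the Schatten class, and the Schatten norm dominates the
operator norm. -/
theorem IsDoubleOperatorIntegralSchatten.unique {P : SpectralMeasure α H} {Q : SpectralMeasure β H}
    {φ : α × β → ℂ} {p : ℝ} {hp : 1 ≤ p} {Φ Ψ : schattenClass H p hp →ₗ[ℂ] schattenClass H p hp}
    (hΦ : IsDoubleOperatorIntegralSchatten P Q φ p hp Φ)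
    (hΨ : IsDoubleOperatorIntegralSchatten P Q φ p hp Ψ) : Ψ = Φ := by
  obtain ⟨C, hC⟩ := hΦ.bounded
  obtain ⟨D, hD⟩ := hΨ.bounded
  refine LinearMap.ext fun T => Subtype.ext (sub_eq_zero.1 (norm_le_zero_iff.1 ?_))
  refine le_of_forall_pos_le_add fun ε hε => ?_
  rw [zero_add]
  obtain ⟨F, r, hF, hlt⟩ := exists_schattenNorm_sub_lt hp T.2
    (ε := ε / (|C| + |D| + 1)) (by positivity)
  let F' : schattenClass H p hp := ⟨F, memSchatten_of_rank_le hF hp⟩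
  have hF1 : MemSchatten 1 (F' : H →L[ℂ] H) := memSchatten_of_rank_le hF le_rfl
  have h1 : ((Ψ F' : schattenClass H p hp) : H →L[ℂ] H) = Φ F' :=
    (hΨ.apply_traceClass F' hF1).unique (hΦ.apply_traceClass F' hF1)
  have h2 : ((Ψ T : H →L[ℂ] H) - Φ T) =
      (Ψ (T - F') : H →L[ℂ] H) - (Φ (T - F') : H →L[ℂ] H) := by
    rw [map_sub, map_sub, Submodule.coe_sub, Submodule.coe_sub, h1, sub_sub_sub_cancel_right]
  have h3 : 0 ≤ schattenNorm p (T - F' : schattenClass H p hp).1 :=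
    (norm_nonneg _).trans (norm_le_schattenNorm hp (T - F').2)
  have h4 : ∀ {X : schattenClass H p hp →ₗ[ℂ] schattenClass H p hp} {K : ℝ},
      (∀ A : schattenClass H p hp, schattenNorm p (X A : H →L[ℂ] H) ≤
        K * schattenNorm p (A : H →L[ℂ] H)) →
      ‖(X (T - F') : H →L[ℂ] H)‖ ≤ |K| * schattenNorm p (T - F' : schattenClass H p hp).1 :=
    fun {X K} hK => (norm_le_schattenNorm hp (X (T - F')).2).trans ((hK _).trans
      (mul_le_mul_of_nonneg_right (le_abs_self K) h3))
  have hlt' : schattenNorm p (T - F' : schattenClass H p hp).1 < ε / (|C| + |D| + 1) := hlt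
  rw [h2]
  rw [lt_div_iff₀ (by positivity)] at hlt'
  have h5 := norm_sub_le (Ψ (T - F') : H →L[ℂ] H) (Φ (T - F') : H →L[ℂ] H)
  have h6 := h4 hC
  have h7 := h4 hD
  nlinarith

end SchattenAverage

/-! ### Ultraweakly continuous functionals -/

section Ultraweak

variable {H : Type*} [NormedAddCommGroup H] [InnerProductSpace ℂ H]

theorem norm_inner_apply_le (u v : H) (T : H →L[ℂ] H) {C : ℝ} (hC : ‖T‖ ≤ C) :
    ‖inner ℂ v (T u)‖ ≤ (‖u‖ ^ 2 + ‖v‖ ^ 2) * C := by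
  have hC0 : 0 ≤ C := (norm_nonneg T).trans hC
  calc ‖inner ℂ v (T u)‖ ≤ ‖v‖ * ‖T u‖ := norm_inner_le_norm _ _
    _ ≤ ‖v‖ * (C * ‖u‖) := by gcongr; exact T.le_of_opNorm_le hC u
    _ = (‖u‖ * ‖v‖) * C := by ring
    _ ≤ (‖u‖ ^ 2 + ‖v‖ ^ 2) * C := by
      gcongr
      nlinarith [sq_nonneg (‖u‖ - ‖v‖), sq_nonneg ‖u‖, sq_nonneg ‖v‖]

theorem tendsto_tsum_inner {u v : ℕ → H} (hu : Summable fun n => ‖u n‖ ^ 2)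
    (hv : Summable fun n => ‖v n‖ ^ 2) {T : ℕ → H →L[ℂ] H} {S : H →L[ℂ] H} {C : ℝ}
    (hC : ∀ N, ‖T N‖ ≤ C)
    (hT : ∀ x, Filter.Tendsto (fun N => T N x) Filter.atTop (nhds (S x))) :
    Filter.Tendsto (fun N => ∑' n, inner ℂ (v n) (T N (u n))) Filter.atTop
      (nhds (∑' n, inner ℂ (v n) (S (u n)))) :=
  tendsto_tsum_of_dominated_convergence ((hu.add hv).mul_right C)
    (fun n => tendsto_const_nhds.inner (hT (u n)))
    (Filter.Eventually.of_forall fun N _ => norm_inner_apply_le _ _ _ (hC N))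

theorem IsUltraweaklyContinuous.tendsto {ω : (H →L[ℂ] H) →ₗ[ℂ] ℂ} (hω : IsUltraweaklyContinuous ω)
    {T : ℕ → H →L[ℂ] H} {S : H →L[ℂ] H} {C : ℝ} (hC : ∀ N, ‖T N‖ ≤ C)
    (hT : ∀ x, Filter.Tendsto (fun N => T N x) Filter.atTop (nhds (S x))) :
    Filter.Tendsto (fun N => ω (T N)) Filter.atTop (nhds (ω S)) := by
  obtain ⟨u, v, hu, hv, h⟩ := hω
  simp_rw [← fun A => (h A).tsum_eq]
  exact tendsto_tsum_inner hu hv hC hT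

theorem IsUltraweaklyContinuous.exists_norm_le {ω : (H →L[ℂ] H) →ₗ[ℂ] ℂ}
    (hω : IsUltraweaklyContinuous ω) : ∃ C : ℝ, 0 ≤ C ∧ ∀ T, ‖ω T‖ ≤ C * ‖T‖ := by
  obtain ⟨u, v, hu, hv, h⟩ := hω
  refine ⟨∑' n, (‖u n‖ ^ 2 + ‖v n‖ ^ 2), tsum_nonneg fun n => by positivity, fun T => ?_⟩
  rw [← (h T).tsum_eq]
  exact tsum_of_norm_bounded ((hu.add hv).hasSum.mul_right ‖T‖) fun n =>
    norm_inner_apply_le _ _ _ le_rfl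

theorem exists_isUltraweaklyContinuous_inner (h k : H) : ∃ ω : (H →L[ℂ] H) →ₗ[ℂ] ℂ,
    IsUltraweaklyContinuous ω ∧ ∀ T, ω T = inner ℂ k (T h) := by
  have hsum : ∀ x : H, Summable fun n => ‖(Pi.single 0 x : ℕ → H) n‖ ^ 2 := fun x =>
    summable_of_ne_finset_zero (s := {0}) fun n hn => by
      rw [Pi.single_eq_of_ne (by simpa using hn)]; simp
  refine ⟨(innerSL ℂ k : H →ₗ[ℂ] ℂ) ∘ₗ (ContinuousLinearMap.apply ℂ H h : (H →L[ℂ] H) →ₗ[ℂ] H),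
    ⟨Pi.single 0 h, Pi.single 0 k, hsum h, hsum k, fun T => ?_⟩, fun T => rfl⟩
  have h1 := hasSum_single (f := fun n => inner ℂ ((Pi.single 0 k : ℕ → H) n)
    (T ((Pi.single 0 h : ℕ → H) n))) 0 fun n hn => by
      rw [Pi.single_eq_of_ne hn, inner_zero_left]
  simpa using h1

theorem rank_comp_le_of_rank_le (T : H →L[ℂ] H) {F : H →L[ℂ] H} {r : ℕ}
    (hF : LinearMap.rank (F : H →ₗ[ℂ] H) ≤ (r : Cardinal)) :
    LinearMap.rank ((T ∘L F : H →L[ℂ] H) : H →ₗ[ℂ] H) ≤ (r : Cardinal) :=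
  (LinearMap.rank_comp_le_right (F : H →ₗ[ℂ] H) (T : H →ₗ[ℂ] H)).trans hF

/-- A bounded functional that is continuous along the compressions `T π_N` is ultraweakly
continuous: on rank one operators it is `|y⟩⟨z| ↦ ⟪z, ρ y⟫` for a bounded operator `ρ`, Ky Fan's
principle shows that `ρ` is of trace class, and a decomposition of `ρ` into rank one terms gives
the two sequences. -/
theorem isUltraweaklyContinuous_of_tendsto [CompleteSpace H] {ω : (H →L[ℂ] H) →ₗ[ℂ] ℂ} {C : ℝ}
    (hC0 : 0 ≤ C) (hC : ∀ T, ‖ω T‖ ≤ C * ‖T‖) {π : ℕ → H →L[ℂ] H} (hπ1 : ∀ N, ‖π N‖ ≤ 1)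
    (hr : ∀ N, ∃ r : ℕ, LinearMap.rank (π N : H →ₗ[ℂ] H) ≤ (r : Cardinal))
    (hπ : ∀ x, Filter.Tendsto (fun N => π N x) Filter.atTop (nhds x))
    (hω : ∀ T : H →L[ℂ] H, Filter.Tendsto (fun N => ω (T ∘L π N)) Filter.atTop (nhds (ω T))) :
    IsUltraweaklyContinuous ω := by
  let B : H →L⋆[ℂ] H →L[ℂ] ℂ :=
    (ContinuousLinearMap.compL ℂ H (H →L[ℂ] H) ℂ (ω.mkContinuous C hC)).comp
      (InnerProductSpace.rankOne ℂ : H →L[ℂ] H →L⋆[ℂ] H →L[ℂ] H).flip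
  set ρ : H →L[ℂ] H := ContinuousLinearMap.adjoint
    (InnerProductSpace.continuousLinearMapOfBilin B) with hρ_def
  have hρ : ∀ y z, ω (InnerProductSpace.rankOne ℂ y z) = inner ℂ z (ρ y) := fun y z => by
    rw [hρ_def, ContinuousLinearMap.adjoint_inner_right,
      InnerProductSpace.continuousLinearMapOfBilin_apply]
    rfl
  have hρ1 : MemSchatten 1 ρ := by
    refine summable_of_sum_range_le (c := C) (fun n => by
      rw [Real.rpow_one]; exact singularValue_nonneg ρ n) fun N => ?_
    simp_rw [Real.rpow_one]
    refine le_of_forall_pos_le_add fun ε hε => ?_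
    obtain ⟨e, f, he, hf, -, -, hsum⟩ := exists_sum_singularValue_le N ρ hε
    refine hsum.trans (add_le_add_left ((Complex.re_le_norm _).trans ?_) ε)
    simp_rw [← hρ, ← map_sum]
    exact (hC _).trans (mul_le_of_le_one_right hC0 (norm_sum_rankOne_le he hf N))
  obtain ⟨u, v, hu, hv, huv⟩ := hρ1.exists_hasSum_rankOne
  have hone : ∀ y z, HasSum (fun n => inner ℂ (u n) (InnerProductSpace.rankOne ℂ y z (v n)))
      (ω (InnerProductSpace.rankOne ℂ y z)) := fun y z => by
    rw [hρ]
    refine ((innerSL ℂ z).hasSum (huv y)).congr_fun fun n => ?_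
    simp [mul_comm]
  have hfin : ∀ (D : H →L[ℂ] H) (r : ℕ), LinearMap.rank (D : H →ₗ[ℂ] H) ≤ (r : Cardinal) →
      HasSum (fun n => inner ℂ (u n) (D (v n))) (ω D) := fun D r hD => by
    obtain ⟨a, b, -, -, -, -, hab⟩ := exists_eq_sum_rankOne hD
    have h1 : D = ∑ i ∈ Finset.range r, InnerProductSpace.rankOne ℂ (b i) (a i) := by
      ext x
      rw [hab, _root_.sum_apply]
      rfl
    rw [h1, map_sum]
    refine (hasSum_sum fun i (_ : i ∈ Finset.range r) => hone (b i) (a i)).congr_fun fun n => ?_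
    rw [_root_.sum_apply, inner_sum]
  refine ⟨v, u, hv, hu, fun T => ?_⟩
  have hs : Summable fun n => inner ℂ (u n) (T (v n)) :=
    Summable.of_norm_bounded ((hv.add hu).mul_right ‖T‖) fun n => norm_inner_apply_le _ _ _ le_rfl
  have h1 := tendsto_tsum_inner hv hu (T := fun N => T ∘L π N) (S := T) (C := ‖T‖)
    (fun N => (T.opNorm_comp_le _).trans (mul_le_of_le_one_right (norm_nonneg T) (hπ1 N)))
    fun x => (T.continuous.tendsto _).comp (hπ x)
  have h2 : ∀ N, ∑' n, inner ℂ (u n) ((T ∘L π N) (v n)) = ω (T ∘L π N) := fun N => by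
    obtain ⟨r, hr⟩ := hr N
    exact (hfin _ r (rank_comp_le_of_rank_le T hr)).tsum_eq
  simp_rw [h2] at h1
  rw [tendsto_nhds_unique (hω T) h1]
  exact hs.hasSum

variable [CompleteSpace H] [SeparableSpace H]

theorem IsContractionFamily.isUltraweaklyContinuous_comp_average {U V : ℝ → H →L[ℂ] H} {f : ℝ → ℂ}
    (hU : IsContractionFamily U) (hV : IsContractionFamily V) (hf : Integrable f)
    {Φ : (H →L[ℂ] H) →L[ℂ] (H →L[ℂ] H)} (hΦ : ∀ T h, Φ T h = ∫ t, f t • U t (T (V t h)))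
    {ω : (H →L[ℂ] H) →ₗ[ℂ] ℂ} (hω : IsUltraweaklyContinuous ω) :
    IsUltraweaklyContinuous (ω ∘ₗ (Φ : (H →L[ℂ] H) →ₗ[ℂ] (H →L[ℂ] H))) := by
  obtain ⟨π, hπ1, hr, hπ⟩ := exists_finiteRank_tendsto_id (H := H)
  obtain ⟨C, hC0, hC⟩ := hω.exists_norm_le
  have hTπ : ∀ (T : H →L[ℂ] H) N, ‖T ∘L π N‖ ≤ ‖T‖ := fun T N =>
    (T.opNorm_comp_le _).trans (mul_le_of_le_one_right (norm_nonneg T) (hπ1 N))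
  refine isUltraweaklyContinuous_of_tendsto (C := C * ‖Φ‖) (by positivity) (fun T => ?_) hπ1 hr hπ
    fun T => ?_
  · rw [mul_assoc]
    exact (hC (Φ T)).trans (mul_le_mul_of_nonneg_left (Φ.le_opNorm T) hC0)
  · refine hω.tendsto (T := fun N => Φ (T ∘L π N)) (C := ‖Φ‖ * ‖T‖)
      (fun N => (Φ.le_opNorm _).trans
        (mul_le_mul_of_nonneg_left (hTπ T N) (norm_nonneg Φ))) fun h => ?_
    change Filter.Tendsto _ _ (nhds (Φ T h))
    simp_rw [hΦ]
    refine tendsto_integral_of_dominated_convergence (fun t => ‖f t‖ * (‖T‖ * ‖h‖))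
      (fun N => (hU.integrable hV hf _ h).1) (hf.norm.mul_const _)
      (fun N => Filter.Eventually.of_forall fun t => ?_) (Filter.Eventually.of_forall fun t => ?_)
    · rw [norm_smul]
      gcongr
      exact (hU.norm_apply_le hV _ h t).trans
        (mul_le_mul_of_nonneg_right (hTπ T N) (norm_nonneg h))
    · exact (((U t ∘L T).continuous.tendsto _).comp (hπ (V t h))).const_smul (f t)

/-- Ultraweak continuity determines the operator by its values on finite rank operators. -/
theorem IsDoubleOperatorIntegralBounded.unique {α β : Type*} [MeasurableSpace α]
    [MeasurableSpace β] {P : SpectralMeasure α H} {Q : SpectralMeasure β H} {φ : α × β → ℂ}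
    {Φ Ψ : (H →L[ℂ] H) →L[ℂ] (H →L[ℂ] H)} (hΦ : IsDoubleOperatorIntegralBounded P Q φ Φ)
    (hΨ : IsDoubleOperatorIntegralBounded P Q φ Ψ) : Ψ = Φ := by
  obtain ⟨π, hπ1, hr, hπ⟩ := exists_finiteRank_tendsto_id (H := H)
  refine ContinuousLinearMap.ext fun T => ContinuousLinearMap.ext fun h =>
    ext_inner_left ℂ fun k => ?_
  obtain ⟨ω, hω, hωT⟩ := exists_isUltraweaklyContinuous_inner h k
  have hlim : ∀ {X : (H →L[ℂ] H) →L[ℂ] (H →L[ℂ] H)}, IsDoubleOperatorIntegralBounded P Q φ X →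
      Filter.Tendsto (fun N => ω (X (T ∘L π N))) Filter.atTop (nhds (ω (X T))) := fun {X} hX =>
    IsUltraweaklyContinuous.tendsto
      (ω := ω ∘ₗ (X : (H →L[ℂ] H) →ₗ[ℂ] (H →L[ℂ] H))) (T := fun N => T ∘L π N)
      (hX.ultraweak ω hω) (C := ‖T‖)
      (fun N => (T.opNorm_comp_le _).trans (mul_le_of_le_one_right (norm_nonneg T) (hπ1 N)))
      fun x => (T.continuous.tendsto _).comp (hπ x)
  rw [← hωT (Ψ T), ← hωT (Φ T)]
  refine tendsto_nhds_unique (hlim hΨ) ((hlim hΦ).congr fun N => ?_)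
  obtain ⟨r, hr⟩ := hr N
  have h1 : MemSchatten 1 (T ∘L π N) :=
    memSchatten_of_rank_le (rank_comp_le_of_rank_le T hr) le_rfl
  have h2 : Φ (T ∘L π N) = Ψ (T ∘L π N) :=
    (hΦ.apply_traceClass _ h1).unique (hΨ.apply_traceClass _ h1)
  change ω (Φ (T ∘L π N)) = ω (Ψ (T ∘L π N))
  rw [h2]

end Ultraweak

end

/-! ### The double operator integral -/

theorem mainTheorem2 {H : Type*} [NormedAddCommGroup H] [InnerProductSpace ℂ H] [CompleteSpace H]
    [SeparableSpace H] (P Q : SpectralMeasure ℝ H) (f : ℝ → ℂ) (hf : Integrable f) :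
    (∀ (p : ℝ) (hp : 1 ≤ p), ∃ Φ : schattenClass H p hp →ₗ[ℂ] schattenClass H p hp,
      IsDoubleOperatorIntegralSchatten P Q (fun x => fourierHat f (x.1 - x.2)) p hp Φ ∧
      (∀ Ψ, IsDoubleOperatorIntegralSchatten P Q (fun x => fourierHat f (x.1 - x.2)) p hp Ψ →
        Ψ = Φ) ∧
      ∀ T : schattenClass H p hp,
        schattenNorm p (Φ T : H →L[ℂ] H) ≤ (∫ t, ‖f t‖) * schattenNorm p (T : H →L[ℂ] H)) ∧
    ∃ Φ : (H →L[ℂ] H) →L[ℂ] (H →L[ℂ] H),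
      IsDoubleOperatorIntegralBounded P Q (fun x => fourierHat f (x.1 - x.2)) Φ ∧
      (∀ Ψ, IsDoubleOperatorIntegralBounded P Q (fun x => fourierHat f (x.1 - x.2)) Ψ → Ψ = Φ) ∧
      ‖Φ‖ ≤ ∫ t, ‖f t‖ := by
  have hU := P.isContractionFamily_exp_neg
  have hV := Q.isContractionFamily_exp
  obtain ⟨Φ, hΦ, hΦf⟩ := hU.exists_average hV hf
  refine ⟨fun p hp => ?_, Φ, ?_⟩
  · have hS : ∀ T : H →L[ℂ] H, MemSchatten p T →
        MemSchatten p (Φ T) ∧ schattenNorm p (Φ T) ≤ (∫ t, ‖f t‖) * schattenNorm p T := fun T hT =>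
      hT.of_sum_singularValue_le hp (integral_nonneg fun t => norm_nonneg _) fun N =>
        hU.sum_singularValue_average_le hV hf (hΦ T) N
    let Φp : schattenClass H p hp →ₗ[ℂ] schattenClass H p hp :=
      (Φ : (H →L[ℂ] H) →ₗ[ℂ] (H →L[ℂ] H)).restrict fun T hT => (hS T hT).1
    have hΦp : IsDoubleOperatorIntegralSchatten P Q (fun x => fourierHat f (x.1 - x.2)) p hp Φp :=
      ⟨⟨∫ t, ‖f t‖, fun T => (hS T T.2).2⟩,
        fun T hT => hasOperatorIntegral_fourierHat P Q hf hT (hΦ T)⟩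
    exact ⟨Φp, hΦp, fun Ψ hΨ => hΦp.unique hΨ, fun T => (hS T T.2).2⟩
  · have hΦb : IsDoubleOperatorIntegralBounded P Q (fun x => fourierHat f (x.1 - x.2)) Φ :=
      ⟨fun ω hω => hU.isUltraweaklyContinuous_comp_average hV hf hΦ hω,
        fun T hT => hasOperatorIntegral_fourierHat P Q hf hT (hΦ T)⟩
    exact ⟨hΦb, fun Ψ hΨ => hΦb.unique hΨ, hΦf⟩
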